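/- Let $q$ be a prime power, $\mathbb F=\mathbb F_{q^2}$, and let $R=\mathbb F[X,Y]/(X^{q+1}-Y^q-Y)=\mathbb F[x,y]$ be the coordinate ring of the Hermitian curve, with fraction field $\mathbb F(x,y)$. Every $f\in R$ is uniquely $f=\sum_{a\ge 0,\,0\le b<q}f_{a,b}x^ay^b$; for $f\neq 0$ put $\rho(f)=\max\{aq+b(q+1): f_{a,b}\ne 0\}$. Let $z^*_0=y^{q-1}+1$ and $z^*_b=y^{q-1-b}$ for $1\le b<q$. Let $e=(e_P)$ be any vector with entries in $\mathbb F$ indexed by the $\mathbb F$-rational affine points $P=(\alpha_P,\beta_P)$ of the curve. Put $$I^e=\{f\in R: f(P)=0\text{ whenever }e_P\ne 0\},\qquad S=\sum_P e_P\,\frac{x^{q+1}-\alpha_P^{q+1}}{(x-\alpha_P)(y-\beta_P)}\in\mathbb F(x,y),$$ and $s_{a,b}=\sum_P e_P\alpha_P^a\beta_P^b$ for $a\ge 0$, $s_{a,b}=0$ for $a<0$. Let $\Delta^e=\rho(R\setminus\{0\})\setminus\rho(I^e\setminus\{0\})$, $\sigma_i=\min\{\rho(f):0\ne f\in I^e,\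 \rho(f)\equiv i \bmod q\}$ for $0\le i<q$, $\sigma_{\max}=\max_i\sigma_i$, and $\delta_{\max}=\max\Delta^e$ (with $\delta_{\max}=0$ if $e=0$, when $\Delta^e=\emptyset$). Define $f_i^{(m)},\varphi_i^{(m)},g_i^{(m)},\psi_i^{(m)}\in R$ for $0\le i<q$ and $m\ge 0$ as follows. Initially $f_i^{(0)}=y^i$, $\varphi_i^{(0)}=0$, $g_i^{(0)}=0$, $\psi_i^{(0)}=-z^*_i$. Given the data for $m$, for every ordered pair $(i,j)$ with $0\le i,j<q$ and $i+j\equiv m\bmod q$ set $$d_i=\rho(f_i^{(m)}),\quad d_j=\rho(f_j^{(m)}),\quad r_i=\frac{m-d_i-j(q+1)}{q},\quad p=\frac{d_i+d_j-m}{q}-1,\quad \mu_i=\sum_{c=0}^{q-1}\sum_a (y^jf_i^{(m)})_{a,c}\,s_{a+r_i,c},$$ $$U_i^{(m)}=\begin{pmatrix}1&-\mu_ix^p\\0&1\end{pmatrix}\ \text{if }\mu_i=0\text{ or }p\ge 0,\qquad U_i^{(m)}=\begin{pmatrix}x^{-p}&-\mu_i\\1/\mu_i&0\end{pmatrix}\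 \text{otherwise},$$ $$\begin{pmatrix}f_i^{(m+1)}&\varphi_i^{(m+1)}\\g_j^{(m+1)}&\psi_j^{(m+1)}\end{pmatrix}=U_i^{(m)}\begin{pmatrix}f_i^{(m)}&\varphi_i^{(m)}\\g_j^{(m)}&\psi_j^{(m)}\end{pmatrix}.$$ Then the minima $\sigma_i$ exist for all $i$, and the maximum of $\Delta^e$ exists if $e\neq 0$. For every $m>\sigma_{\max}+\delta_{\max}$, each of the polynomials $f_i^{(m)}$ ($0\le i<q$) belongs to $I^e$. With $M=\sigma_{\max}+\max\{\delta_{\max},\,q^2-q-1\}$, each of the pairs $f_i^{(M+1)},\varphi_i^{(M+1)}$ satisfies the key equation $f_i^{(M+1)}S=\varphi_i^{(M+1)}$. -/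

import Mathlib

namespace Hermitian

open Polynomial

noncomputable section

variable (q : ℕ) (F : Type*) [Field F]

/-- The polynomial `Y ^ q + Y - X ^ (q + 1)` in `F[X][Y]`, whose zeros are the points of the
Hermitian curve. -/
def curvePoly : F[X][X] := X ^ q + X - C (X ^ (q + 1))

/-- The coordinate ring `F[x, y] = F[X, Y] / (X ^ (q + 1) - Y ^ q - Y)`. -/
abbrev CoordRing : Type _ := AdjoinRoot (curvePoly q F)

section Domain

theorem one_lt_of_primePow [hq : Fact (IsPrimePow q)] : 1 < q := hq.out.one_lt

theorem curvePoly_monic [Fact (IsPrimePow q)] : (curvePoly q F).Monic := by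
  have h := one_lt_of_primePow q
  have e : curvePoly q F = X ^ q + (X - C (X ^ (q + 1))) := by
    unfold curvePoly; ring
  rw [e]
  refine monic_X_pow_add ?_
  rw [degree_X_sub_C]
  exact_mod_cast h

theorem curvePoly_irreducible [Fact (IsPrimePow q)] : Irreducible (curvePoly q F) := by
  have h := one_lt_of_primePow q
  -- the same polynomial, up to sign, read in `F[Y][X]`
  let P : F[X][X] := X ^ (q + 1) - C (X ^ q + X)
  have hdeg : P.natDegree = q + 1 := natDegree_X_pow_sub_C
  have hmon : P.Monic := monic_X_pow_sub_C _ (by omega)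
  have hprime : (Ideal.span {(X : F[X])}).IsPrime := by
    rw [Ideal.span_singleton_prime X_ne_zero]
    exact prime_X
  have hE : P.IsEisensteinAt (Ideal.span {(X : F[X])}) := by
    refine ⟨?_, ?_, ?_⟩
    · rw [hmon.leadingCoeff]
      exact fun h1 => hprime.ne_top ((Ideal.eq_top_iff_one _).2 h1)
    · intro n hn
      rw [hdeg] at hn
      rw [Ideal.mem_span_singleton]
      simp only [P, coeff_sub, coeff_X_pow, if_neg hn.ne, coeff_C, zero_sub]
      split_ifs
      · rw [dvd_neg]
        exact dvd_add (dvd_pow_self _ (by omega)) dvd_rfl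
      · simp
    · rw [Ideal.span_singleton_pow, Ideal.mem_span_singleton]
      intro hd
      rw [X_pow_dvd_iff] at hd
      have := hd 1 (by norm_num)
      rw [coeff_sub, coeff_X_pow, if_neg (by omega), coeff_C_zero, zero_sub, coeff_neg, coeff_add,
        coeff_X_pow, if_neg h.ne, coeff_X_one, zero_add] at this
      exact one_ne_zero (neg_eq_zero.1 this)
  have hPirr : Irreducible P := hE.irreducible hprime hmon.isPrimitive (by omega)
  have hswap : curvePoly q F = -(Polynomial.Bivariate.swap (R := F) P) := by
    simp only [P, curvePoly, map_sub, map_add, map_pow, Bivariate.swap_Y,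
      Bivariate.swap_C]
    simp
  rw [hswap, (Associated.refl (Polynomial.Bivariate.swap (R := F) P)).neg_left.irreducible_iff]
  exact (MulEquiv.irreducible_iff (Polynomial.Bivariate.swap (R := F))).2 hPirr

end Domain

instance [Fact (IsPrimePow q)] : IsDomain (CoordRing q F) :=
  AdjoinRoot.isDomain_of_prime (curvePoly_irreducible q F).prime

/-- The function field `F(x, y)` of the curve. -/
abbrev FunField : Type _ := FractionRing (CoordRing q F)

/-- The class of `X` in the coordinate ring. -/
def x : CoordRing q F := AdjoinRoot.of (curvePoly q F) X

/-- The class of `Y` in the coordinate ring. -/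
def y : CoordRing q F := AdjoinRoot.root (curvePoly q F)

/-- The points `(α, β)` of the Hermitian curve with coordinates in `F`. -/
abbrev Point : Type _ := {P : F × F // P.1 ^ (q + 1) = P.2 ^ q + P.2}

variable {q F}

/-- Evaluation `f ↦ f(α, β)` of elements of the coordinate ring at a point. -/
def evalAt (P : Point q F) : CoordRing q F →+* F :=
  AdjoinRoot.lift (evalRingHom P.1.1) P.1.2 (by
    simp only [curvePoly, eval₂_sub, eval₂_add, eval₂_pow, eval₂_X, eval₂_C, coe_evalRingHom,
      eval_pow, eval_X, P.2, sub_self])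

/-- The ideal `I ^ e` of all `f` vanishing at every point where `e` is nonzero. -/
def locatorIdeal (e : Point q F → F) : Ideal (CoordRing q F) where
  carrier := {f | ∀ P, e P ≠ 0 → evalAt P f = 0}
  add_mem' hf hg P hP := by rw [map_add, hf P hP, hg P hP, add_zero]
  zero_mem' P _ := map_zero _
  smul_mem' c f hf P hP := by rw [smul_eq_mul, map_mul, hf P hP, mul_zero]

section Finite

variable [Fintype F]

open Classical in
/-- The syndrome `S = ∑ e_P (x ^ (q+1) - α ^ (q+1)) / ((x - α) (y - β))` of `e`, the sum being
over all points `P = (α, β)` of the curve. -/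
def syndrome [Fact (IsPrimePow q)] (e : Point q F → F) : FunField q F :=
  ∑ P : Point q F,
    algebraMap (CoordRing q F) (FunField q F) (algebraMap F (CoordRing q F) (e P)) *
      (algebraMap (CoordRing q F) (FunField q F)
          (x q F ^ (q + 1) - algebraMap F (CoordRing q F) (P.1.1 ^ (q + 1))) /
        algebraMap (CoordRing q F) (FunField q F)
          ((x q F - algebraMap F (CoordRing q F) P.1.1) *
            (y q F - algebraMap F (CoordRing q F) P.1.2)))

open Classical in
/-- The syndrome values `s_{a,b} = ∑ e_P α ^ a β ^ b`, with `s_{a,b} = 0` for `a < 0`. -/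
def syndromeValue (e : Point q F → F) (a : ℤ) (b : ℕ) : F :=
  if 0 ≤ a then ∑ P : Point q F, e P * P.1.1 ^ a.toNat * P.1.2 ^ b else 0

/-- The pair `f, φ` solves the key equation for the syndrome of `e`: `f S = φ`. -/
def SolvesKeyEquation [Fact (IsPrimePow q)] (e : Point q F → F) (f φ : CoordRing q F) : Prop :=
  algebraMap (CoordRing q F) (FunField q F) f * syndrome e =
    algebraMap (CoordRing q F) (FunField q F) φ

end Finite

/-- The index `j` with `0 ≤ j < q` and `i + j ≡ m` modulo `q`. -/
def partner (m : ℕ) (i : Fin q) : Fin q :=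
  ⟨(m + (q - (i : ℕ))) % q, Nat.mod_lt _ i.pos⟩

theorem add_partner_modEq (m : ℕ) (i : Fin q) : (i : ℕ) + (partner m i : ℕ) ≡ m [MOD q] := by
  have h : (i : ℕ) + (m + (q - (i : ℕ))) = m + q := by have := i.isLt; omega
  calc (i : ℕ) + (partner m i : ℕ) ≡ (i : ℕ) + (m + (q - (i : ℕ))) [MOD q] :=
        Nat.ModEq.add_left _ (Nat.mod_modEq _ _)
    _ ≡ m [MOD q] := by rw [h]; exact Nat.add_modEq_right

theorem eq_partner {m : ℕ} {i j : Fin q} (h : (i : ℕ) + (j : ℕ) ≡ m [MOD q]) :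
    j = partner m i := by
  have h2 := Nat.ModEq.add_left_cancel' (i : ℕ) (h.trans (add_partner_modEq m i).symm)
  exact Fin.ext (Nat.ModEq.eq_of_lt_of_lt h2 j.isLt (partner m i).isLt)

variable [Fact (IsPrimePow q)]

/-- The unique polynomial `f_0(X) + f_1(X) Y + ⋯ + f_{q-1}(X) Y ^ (q-1)` representing `f`. -/
def stdRepr (f : CoordRing q F) : F[X][X] :=
  AdjoinRoot.modByMonicHom (curvePoly_monic q F) f

/-- The coefficient `f_{a,b}` of `x ^ a y ^ b` in `f`, with respect to the basis
`x ^ a y ^ b`, `0 ≤ a`, `0 ≤ b < q`. -/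
def stdCoeff (f : CoordRing q F) (a b : ℕ) : F := ((stdRepr f).coeff b).coeff a

/-- The order function `ρ`: the maximum of `a q + b (q+1)` over all `(a, b)` with `f_{a,b} ≠ 0`,
and `⊥` for `f = 0`. -/
def rho (f : CoordRing q F) : WithBot ℕ :=
  (stdRepr f).support.sup fun b =>
    ((stdRepr f).coeff b).support.sup fun a => ((a * q + b * (q + 1) : ℕ) : WithBot ℕ)

/-- The order as an integer; only meaningful for `f ≠ 0`. -/
def rhoInt (f : CoordRing q F) : ℤ := (((rho f).unbotD 0 : ℕ) : ℤ)

variable (q F) in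
/-- The set `Λ` of orders of nonzero elements of the coordinate ring. -/
def orders : Set ℕ := {n | ∃ f : CoordRing q F, rho f = (n : WithBot ℕ)}

/-- The set `ρ(I)` of orders of nonzero elements of an ideal. -/
def ordersOf (I : Ideal (CoordRing q F)) : Set ℕ := {n | ∃ f ∈ I, rho f = (n : WithBot ℕ)}

/-- The footprint `Δ ^ e = Λ \ ρ(I ^ e)`. -/
def footprint (e : Point q F → F) : Set ℕ := orders q F \ ordersOf (locatorIdeal e)

/-- The orders of nonzero elements of `I ^ e` that are congruent to `i` modulo `q`. -/
def residueOrders (e : Point q F → F) (i : Fin q) : Set ℕ :=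
  {n | n ∈ ordersOf (locatorIdeal e) ∧ n ≡ i [MOD q]}

/-- `σ_i`, the least order of a nonzero element of `I ^ e` congruent to `i` modulo `q`. -/
def sigma (e : Point q F → F) (i : Fin q) : ℕ := sInf (residueOrders e i)

/-- `σ_max`, the maximum of the `σ_i`. -/
def sigmaMax (e : Point q F → F) : ℕ := Finset.univ.sup (sigma e)

/-- `δ_max`, the maximum of the footprint (`0` for the empty footprint of `e = 0`). -/
def deltaMax (e : Point q F → F) : ℕ := sSup (footprint e)

/-- `M = σ_max + max (δ_max, q ^ 2 - q - 1)`. -/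
def lastIteration (e : Point q F → F) : ℕ := sigmaMax e + max (deltaMax e) (q ^ 2 - q - 1)

/-- The data `f_i, φ_i, g_i, ψ_i` (`0 ≤ i < q`) held by the decoding algorithm. -/
@[ext]
structure State (q : ℕ) (F : Type*) [Field F] where
  /-- the polynomials `f_i` -/
  f : Fin q → CoordRing q F
  /-- the polynomials `φ_i` -/
  φ : Fin q → CoordRing q F
  /-- the polynomials `g_i` -/
  g : Fin q → CoordRing q F
  /-- the polynomials `ψ_i` -/
  ψ : Fin q → CoordRing q F

variable (q F) in
/-- The elements `z*_b` of the `*`-basis: `y ^ (q-1) + 1` for `b = 0`, and `y ^ (q-1-b)`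
otherwise. -/
def starBasis (b : Fin q) : CoordRing q F :=
  if (b : ℕ) = 0 then y q F ^ (q - 1) + 1 else y q F ^ (q - 1 - (b : ℕ))

variable (q F) in
/-- The initial data `f_i = y ^ i`, `φ_i = 0`, `g_i = 0`, `ψ_i = -z*_i`. -/
def initState : State q F where
  f i := y q F ^ (i : ℕ)
  φ _ := 0
  g _ := 0
  ψ i := -starBasis q F i

/-- The integer `r_i = (m - d_i - j (q+1)) / q` with `d_i = ρ(f_i)`; the division is exact when
`d_i ≡ i` and `i + j ≡ m` modulo `q`. -/
def shift (m : ℕ) (st : State q F) (i j : Fin q) : ℤ :=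
  ((m : ℤ) - rhoInt (st.f i) - ((j : ℕ) : ℤ) * ((q : ℤ) + 1)) / (q : ℤ)

/-- The integer `p = (d_i + d_j - m) / q - 1`; the division is exact when `d_i ≡ i`, `d_j ≡ j` and
`i + j ≡ m` modulo `q`. -/
def gap (m : ℕ) (st : State q F) (i j : Fin q) : ℤ :=
  (rhoInt (st.f i) + rhoInt (st.f j) - (m : ℤ)) / (q : ℤ) - 1

/-- The discrepancy `μ_i = ∑_{c < q} ∑_a (y ^ j f_i)_{a,c} s_{a + r_i, c}`. -/
def discrepancy [Fintype F] (e : Point q F → F) (m : ℕ) (st : State q F) (i j : Fin q) : F :=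
  ∑ c ∈ Finset.range q,
    ∑ a ∈ ((stdRepr (y q F ^ (j : ℕ) * st.f i)).coeff c).support,
      stdCoeff (y q F ^ (j : ℕ) * st.f i) a c *
        syndromeValue e ((a : ℤ) + shift m st i j) c

open Classical in
/-- The update matrix `U_i`. In its first case `x ^ p` is only relevant for `p ≥ 0`, since
otherwise its coefficient `μ_i` is zero. -/
def updateMatrix [Fintype F] (e : Point q F → F) (m : ℕ) (st : State q F) (i j : Fin q) :
    Matrix (Fin 2) (Fin 2) (CoordRing q F) :=
  if discrepancy e m st i j = 0 ∨ 0 ≤ gap m st i j then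
    !![1, -(algebraMap F (CoordRing q F) (discrepancy e m st i j) *
        x q F ^ (gap m st i j).toNat);
      0, 1]
  else
    !![x q F ^ (-gap m st i j).toNat, -algebraMap F (CoordRing q F) (discrepancy e m st i j);
      algebraMap F (CoordRing q F) (discrepancy e m st i j)⁻¹, 0]

/-- The product of `U_i` with the matrix with rows `f_i, φ_i` and `g_j, ψ_j`. -/
def updateBlock [Fintype F] (e : Point q F → F) (m : ℕ) (st : State q F) (i j : Fin q) :
    Matrix (Fin 2) (Fin 2) (CoordRing q F) :=
  updateMatrix e m st i j * !![st.f i, st.φ i; st.g j, st.ψ j]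

/-- Iteration `m`. For every pair `i, j` with `i + j ≡ m` modulo `q`, that is, `j = partner m i`,
the rows of the updated block are the new `f_i, φ_i` and the new `g_j, ψ_j`. -/
def step [Fintype F] (e : Point q F → F) (m : ℕ) (st : State q F) : State q F where
  f i := updateBlock e m st i (partner m i) 0 0
  φ i := updateBlock e m st i (partner m i) 0 1
  g j := updateBlock e m st (partner m j) j 1 0
  ψ j := updateBlock e m st (partner m j) j 1 1

/-- The data after the iterations `0, …, m - 1`: its components are `f_i^(m)`, `φ_i^(m)`,
`g_i^(m)` and `ψ_i^(m)`. -/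
def run [Fintype F] (e : Point q F → F) : ℕ → State q F
  | 0 => initState q F
  | m + 1 => step e m (run e m)

end

end Hermitian

/-! Expand `f S` formally in powers of `1/x` over the elements `z*_j`, which act as a dual basis to
the `y ^ j`. The coefficient of `x ^ (-r-1) z*_j` is `syndromeTrace e r (y ^ j * f)`; for `r ≥ 0`
this is `errorSum e (x ^ r * y ^ j * f)`, where `errorSum e u` is the sum of all `e_P u(P)`. Hence
`f ∈ I^e` exactly when all coefficients with `r ≥ 0` vanish.

The algorithm is a Berlekamp–Massey iteration on `q` coupled pairs. Its invariants
(`invariants_run`) say that `f_i` has leading monomial `x ^ (a i) y ^ i`, that `f_i S - φ_i`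
vanishes at all indices of order below `m - ρ(f_i)`, and that `g_i S - ψ_i` starts at `x ^ (-a i)
z*_i`. The same `a i` occurs in both, so when the step at a pair `(i, j)` raises degrees, the steps
for `f_i` and `f_j` must branch alike. They do because multiplication is commutative: both
discrepancies equal `errorSum e (x ^ n * f_i * f_j)` (`LocatorInvariant.discrepancy_symm`).

If `a i` exceeded the exponent of a minimal element `f` of `I^e` in class `i`, then pairing `g_i`
with a multiple of `f` would be both zero and nonzero; so `ρ(f_i) ≤ σ_i` always
(`AuxiliaryInvariant.order_le_sigma`). Once `m > σ_max + δ_max`, `f_i` therefore pairs to zero with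
all elements of order at most `δ_max`. These represent every class modulo `I^e`, and point
evaluations can be separated, so `f_i ∈ I^e`.

For `f ∈ I^e` the product `f S` is the polynomial part of the expansion
(`solvesKeyEquation_of_mem`). Its indices `r < 0` have order at most `q ^ 2 - q - 1`, so by
iteration `M` all its coefficients have been matched by `φ_i`. -/

namespace Hermitian

open Polynomial

noncomputable section

/-! ### Monomial orders, standard coefficients and `ρ`. -/

section

variable {q : ℕ} {F : Type*} [Field F]

/-- The order `r q + j (q + 1)` of the monomial `x ^ r y ^ j`, where `r` may be negative. -/
def order (q : ℕ) (r : ℤ) (j : ℕ) : ℤ := r * q + j * (q + 1)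

/-- Since `q + 1 ≡ 1` modulo `q`, the order determines `j` modulo `q`, and then `r`. -/
theorem order_injective {r r' : ℤ} {j j' : ℕ} (hj : j < q) (hj' : j' < q)
    (h : order q r j = order q r' j') : r = r' ∧ j = j' := by
  unfold order at h
  have h1 : (q : ℤ) ∣ (j : ℤ) - j' := ⟨r' - r + (j' - j), by linear_combination h⟩
  have h2 : (j : ℤ) - j' = 0 :=
    Int.eq_zero_of_abs_lt_dvd h1 (abs_lt.2 ⟨by omega, by omega⟩)
  have h3 : (j : ℤ) = j' := by omega
  have hq : (q : ℤ) ≠ 0 := by omega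
  refine ⟨?_, by omega⟩
  rw [h3] at h
  exact mul_right_cancel₀ hq (by linear_combination h)

theorem x_pow_mul_eq_smul (p : ℕ) (u : CoordRing q F) : x q F ^ p * u = (X ^ p : F[X]) • u := by
  rw [Algebra.smul_def, AdjoinRoot.algebraMap_eq, map_pow]; rfl

theorem algebraMap_mul_eq_smul (t : F) (u : CoordRing q F) :
    algebraMap F (CoordRing q F) t * u = (C t : F[X]) • u := by
  rw [Algebra.smul_def, AdjoinRoot.algebraMap_eq]; rfl

theorem evalAt_x (P : Point q F) : evalAt P (x q F) = P.1.1 := by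
  simp [evalAt, x]

theorem evalAt_y (P : Point q F) : evalAt P (y q F) = P.1.2 := by
  simp [evalAt, y]

theorem evalAt_smul (P : Point q F) (p : F[X]) (u : CoordRing q F) :
    evalAt P (p • u) = p.eval P.1.1 * evalAt P u := by
  rw [Algebra.smul_def, map_mul, AdjoinRoot.algebraMap_eq]
  simp [evalAt]

section Coefficients

variable [Fact (IsPrimePow q)]

theorem stdRepr_smul (p : F[X]) (u : CoordRing q F) : stdRepr (p • u) = p • stdRepr u :=
  map_smul _ _ _

theorem stdRepr_sub (u v : CoordRing q F) : stdRepr (u - v) = stdRepr u - stdRepr v :=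
  map_sub _ _ _

theorem mk_stdRepr (u : CoordRing q F) : AdjoinRoot.mk (curvePoly q F) (stdRepr u) = u :=
  AdjoinRoot.mk_leftInverse (curvePoly_monic q F) u

theorem natDegree_curvePoly : (curvePoly q F).natDegree = q := by
  have h := one_lt_of_primePow q
  unfold curvePoly
  rw [natDegree_sub_C]
  rw [natDegree_add_eq_left_of_natDegree_lt] <;> simp [h]

theorem natDegree_stdRepr_lt (u : CoordRing q F) : (stdRepr u).natDegree < q := by
  obtain ⟨p, rfl⟩ := AdjoinRoot.mk_surjective u
  have h := one_lt_of_primePow q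
  unfold stdRepr
  rw [AdjoinRoot.modByMonicHom_mk]
  have := natDegree_modByMonic_lt p (curvePoly_monic q F)
    (fun h1 => by have := natDegree_curvePoly (q := q) (F := F); rw [h1] at this; simp at this; omega)
  rwa [natDegree_curvePoly] at this

theorem lt_of_stdCoeff_ne_zero {u : CoordRing q F} {a b : ℕ} (h : stdCoeff u a b ≠ 0) : b < q := by
  by_contra hb
  apply h
  unfold stdCoeff
  rw [coeff_eq_zero_of_natDegree_lt (p := stdRepr u) ((natDegree_stdRepr_lt u).trans_le
    (not_lt.1 hb)), coeff_zero]

theorem eq_sum_coeff (u : CoordRing q F) :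
    u = ∑ c ∈ Finset.range q, (stdRepr u).coeff c • y q F ^ c := by
  conv_lhs => rw [← mk_stdRepr u, (stdRepr u).as_sum_range' q (natDegree_stdRepr_lt u), map_sum]
  refine Finset.sum_congr rfl fun c _ => ?_
  rw [← C_mul_X_pow_eq_monomial, map_mul, map_pow, AdjoinRoot.mk_C, AdjoinRoot.mk_X,
    Algebra.smul_def, AdjoinRoot.algebraMap_eq]
  rfl

theorem stdRepr_smul_y_pow (p : F[X]) {c : ℕ} (hc : c < q) :
    stdRepr (p • y q F ^ c) = C p * X ^ c := by
  have : y q F ^ c = AdjoinRoot.mk (curvePoly q F) (X ^ c) := by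
    rw [map_pow, AdjoinRoot.mk_X]; rfl
  rw [stdRepr_smul, this]
  unfold stdRepr
  rw [AdjoinRoot.modByMonicHom_mk, (modByMonic_eq_self_iff (curvePoly_monic q F)).2, smul_eq_C_mul]
  rw [degree_X_pow, degree_eq_natDegree (curvePoly_monic q F).ne_zero, natDegree_curvePoly]
  exact_mod_cast hc

theorem stdCoeff_smul_y_pow (p : F[X]) {c : ℕ} (hc : c < q) (a b : ℕ) :
    stdCoeff (p • y q F ^ c) a b = if b = c then p.coeff a else 0 := by
  unfold stdCoeff
  rw [stdRepr_smul_y_pow p hc, coeff_C_mul_X_pow]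
  split_ifs <;> simp

theorem stdCoeff_y_pow {c : ℕ} (hc : c < q) (a b : ℕ) :
    stdCoeff (y q F ^ c) a b = if b = c ∧ a = 0 then 1 else 0 := by
  rw [← one_smul F[X] (y q F ^ c), stdCoeff_smul_y_pow _ hc, coeff_one]
  split_ifs <;> simp_all

theorem stdCoeff_zero (a b : ℕ) : stdCoeff (0 : CoordRing q F) a b = 0 := by
  have : stdRepr (0 : CoordRing q F) = 0 := map_zero _
  simp [stdCoeff, this]

theorem stdCoeff_sub (u v : CoordRing q F) (a b : ℕ) :
    stdCoeff (u - v) a b = stdCoeff u a b - stdCoeff v a b := by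
  simp [stdCoeff, stdRepr_sub]

theorem stdCoeff_algebraMap_mul (t : F) (u : CoordRing q F) (a b : ℕ) :
    stdCoeff (algebraMap F (CoordRing q F) t * u) a b = t * stdCoeff u a b := by
  rw [algebraMap_mul_eq_smul]
  simp [stdCoeff, stdRepr_smul]

theorem stdCoeff_x_pow_mul (p : ℕ) (u : CoordRing q F) (a b : ℕ) :
    stdCoeff (x q F ^ p * u) a b = if p ≤ a then stdCoeff u (a - p) b else 0 := by
  rw [x_pow_mul_eq_smul]
  simp [stdCoeff, stdRepr_smul, coeff_X_pow_mul']

theorem stdCoeff_x_pow_mul_add (p : ℕ) (u : CoordRing q F) (a b : ℕ) :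
    stdCoeff (x q F ^ p * u) (a + p) b = stdCoeff u a b := by
  simp [stdCoeff_x_pow_mul]

theorem order_le_of_x_pow_mul {u : CoordRing q F} {p : ℕ} {d : ℤ}
    (h : ∀ a b, stdCoeff u a b ≠ 0 → order q a b ≤ d) (a b : ℕ)
    (hab : stdCoeff (x q F ^ p * u) a b ≠ 0) : order q a b ≤ d + p * q := by
  rw [stdCoeff_x_pow_mul] at hab
  split_ifs at hab with hp
  · have := h _ _ hab
    unfold order at *
    rw [Nat.cast_sub hp] at this
    linarith
  · exact absurd rfl hab

theorem evalAt_eq_sum (P : Point q F) (u : CoordRing q F) :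
    evalAt P u = ∑ c ∈ Finset.range q, ((stdRepr u).coeff c).eval P.1.1 * P.1.2 ^ c := by
  conv_lhs => rw [← mk_stdRepr u]
  unfold evalAt
  rw [AdjoinRoot.lift_mk, eval₂_eq_sum_range' _ (natDegree_stdRepr_lt u)]
  rfl

theorem rho_le_iff {f : CoordRing q F} {n : ℕ} :
    rho f ≤ (n : WithBot ℕ) ↔ ∀ a b, stdCoeff f a b ≠ 0 → a * q + b * (q + 1) ≤ n := by
  unfold rho
  simp only [Finset.sup_le_iff, mem_support_iff, Nat.cast_le]
  constructor
  · intro h a b hab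
    refine h b (fun h0 => hab ?_) a hab
    rw [stdCoeff, h0, coeff_zero]
  · intro h b _ a hab
    exact h a b hab

theorem rho_eq_iff {f : CoordRing q F} {n : ℕ} :
    rho f = (n : WithBot ℕ) ↔ (∃ a b, stdCoeff f a b ≠ 0 ∧ a * q + b * (q + 1) = n) ∧
      ∀ a b, stdCoeff f a b ≠ 0 → a * q + b * (q + 1) ≤ n := by
  constructor
  · intro h
    have hle := rho_le_iff.1 h.le
    refine ⟨?_, hle⟩
    by_contra! hne
    -- A bound that is not attained can be lowered: to `n - 1` if `n > 0`, to `⊥` if `n = 0`.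
    rcases Nat.eq_zero_or_pos n with rfl | hn
    · have : rho f ≤ ⊥ := by
        unfold rho
        simp only [Finset.sup_le_iff, mem_support_iff]
        intro b _ a hab
        exact absurd (Nat.le_zero.1 (hle a b hab)) (hne a b hab)
      rw [h] at this
      simp at this
    · have : rho f ≤ ((n - 1 : ℕ) : WithBot ℕ) := by
        rw [rho_le_iff]
        intro a b hab
        have h1 := hle a b hab
        have h2 := hne a b hab
        omega
      rw [h, Nat.cast_le] at this
      omega
  · rintro ⟨⟨a, b, hab, rfl⟩, hle⟩
    refine le_antisymm (rho_le_iff.2 hle) ?_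
    unfold rho
    have h1 : a ∈ ((stdRepr f).coeff b).support := mem_support_iff.2 hab
    have h2 : b ∈ (stdRepr f).support := by
      rw [mem_support_iff]
      intro h0
      apply hab
      rw [stdCoeff, h0, coeff_zero]
    refine le_trans ?_ (Finset.le_sup (f := fun b => ((stdRepr f).coeff b).support.sup
      fun a => ((a * q + b * (q + 1) : ℕ) : WithBot ℕ)) h2)
    exact Finset.le_sup (f := fun a => ((a * q + b * (q + 1) : ℕ) : WithBot ℕ)) h1

theorem rho_eq_of_lead {f : CoordRing q F} {a b : ℕ} (h : stdCoeff f a b ≠ 0)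
    (hle : ∀ a' b', stdCoeff f a' b' ≠ 0 → order q a' b' ≤ order q a b) :
    rho f = ((a * q + b * (q + 1) : ℕ) : WithBot ℕ) := by
  rw [rho_eq_iff]
  refine ⟨⟨a, b, h, rfl⟩, fun a' b' h' => ?_⟩
  have := hle a' b' h'
  unfold order at this
  exact_mod_cast this

theorem exists_rho_eq {f : CoordRing q F} (hf : f ≠ 0) : ∃ n : ℕ, rho f = (n : WithBot ℕ) := by
  cases h : rho f with
  | coe n => exact ⟨n, rfl⟩
  | bot =>
    exfalso
    apply hf
    have hz : ∀ a b, stdCoeff f a b = 0 := by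
      intro a b
      by_contra hab
      have := (rho_le_iff (f := f) (n := a * q + b * (q + 1))).1 (by rw [h]; exact bot_le)
      have h2 : rho f ≤ ⊥ := h.le
      unfold rho at h2
      simp only [Finset.sup_le_iff, mem_support_iff] at h2
      have h3 := h2 b (fun h0 => hab (by rw [stdCoeff, h0, coeff_zero])) a hab
      exact absurd (le_bot_iff.1 h3) (WithBot.natCast_ne_bot _)
    have : stdRepr f = 0 := by
      ext b a
      exact hz a b
    rw [← mk_stdRepr f, this, map_zero]

end Coefficients

/-! ### The error functional and syndrome traces. -/

section Trace

variable [Fintype F]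

/-- The functional sending `X ^ a` to `s_{a + r, c}`. -/
def syndromeFunctional (e : Point q F → F) (r : ℤ) (c : ℕ) : F[X] →ₗ[F] F :=
  Polynomial.lsum fun a => LinearMap.toSpanSingleton F F (syndromeValue e (a + r) c)

theorem syndromeFunctional_monomial (e : Point q F → F) (r : ℤ) (c a : ℕ) (t : F) :
    syndromeFunctional e r c (monomial a t) = t * syndromeValue e (a + r) c := by
  rw [syndromeFunctional, lsum_apply, sum_monomial_index] <;> simp

theorem syndromeFunctional_X_pow_mul (e : Point q F → F) (r : ℤ) (c p : ℕ) (u : F[X]) :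
    syndromeFunctional e r c (X ^ p * u) = syndromeFunctional e (r + p) c u := by
  induction u using Polynomial.induction_on' with
  | add u v hu hv => rw [mul_add, map_add, map_add, hu, hv]
  | monomial a t =>
    rw [X_pow_mul_monomial, syndromeFunctional_monomial, syndromeFunctional_monomial]
    congr 2
    push_cast
    ring

open Classical in
/-- The functional `u ↦ ∑ e_P u(P)`. -/
def errorSum (e : Point q F → F) : CoordRing q F →+ F where
  toFun u := ∑ P, e P * evalAt P u
  map_zero' := by simp
  map_add' u v := by simp [mul_add, Finset.sum_add_distrib]

open Classical in
theorem errorSum_apply (e : Point q F → F) (u : CoordRing q F) :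
    errorSum e u = ∑ P, e P * evalAt P u := rfl

theorem errorSum_eq_zero_of_mem {e : Point q F → F} {u : CoordRing q F}
    (h : u ∈ locatorIdeal e) : errorSum e u = 0 := by
  classical
  rw [errorSum_apply]
  refine Finset.sum_eq_zero fun P _ => ?_
  by_cases hP : e P = 0
  · rw [hP, zero_mul]
  · rw [h P hP, mul_zero]

theorem syndromeFunctional_natCast (e : Point q F → F) (r c : ℕ) (u : F[X]) :
    syndromeFunctional e r c u =
      errorSum e ((X ^ r * u) • y q F ^ c) := by
  classical
  induction u using Polynomial.induction_on' with
  | add u v hu hv => rw [mul_add, map_add, add_smul, map_add, hu, hv]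
  | monomial a t =>
    rw [syndromeFunctional_monomial, syndromeValue, if_pos (by positivity), errorSum_apply,
      Finset.mul_sum]
    refine Finset.sum_congr rfl fun P _ => ?_
    rw [evalAt_smul, map_pow, evalAt_y]
    have : ((a : ℤ) + r).toNat = a + r := by omega
    rw [this]
    simp
    ring

variable [Fact (IsPrimePow q)]

/-- The functional `x ^ a y ^ c ↦ s_{a + r, c}`, the residue of `x ^ r u S`. -/
def syndromeTrace (e : Point q F → F) (r : ℤ) (u : CoordRing q F) : F :=
  ∑ c ∈ Finset.range q, syndromeFunctional e r c ((stdRepr u).coeff c)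

theorem syndromeTrace_sub (e : Point q F → F) (r : ℤ) (u v : CoordRing q F) :
    syndromeTrace e r (u - v) = syndromeTrace e r u - syndromeTrace e r v := by
  simp [syndromeTrace, stdRepr_sub]

theorem syndromeTrace_zero (e : Point q F → F) (r : ℤ) :
    syndromeTrace e r (0 : CoordRing q F) = 0 := by
  have := syndromeTrace_sub e r (0 : CoordRing q F) 0
  simpa using this

theorem syndromeTrace_algebraMap_mul (e : Point q F → F) (r : ℤ) (t : F) (u : CoordRing q F) :
    syndromeTrace e r (algebraMap F (CoordRing q F) t * u) = t * syndromeTrace e r u := by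
  rw [algebraMap_mul_eq_smul]
  simp [syndromeTrace, stdRepr_smul, Finset.mul_sum, ← smul_eq_C_mul]

theorem syndromeTrace_x_pow_mul (e : Point q F → F) (r : ℤ) (p : ℕ) (u : CoordRing q F) :
    syndromeTrace e r (x q F ^ p * u) = syndromeTrace e (r + p) u := by
  rw [x_pow_mul_eq_smul]
  simp [syndromeTrace, stdRepr_smul, syndromeFunctional_X_pow_mul]

theorem discrepancy_eq_syndromeTrace (e : Point q F → F) (m : ℕ) (st : State q F) (i j : Fin q) :
    discrepancy e m st i j = syndromeTrace e (shift m st i j) (y q F ^ (j : ℕ) * st.f i) := by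
  unfold discrepancy syndromeTrace syndromeFunctional
  refine Finset.sum_congr rfl fun c _ => ?_
  rw [lsum_apply, sum_def]
  rfl

/-- For `r ≥ 0` no index `a + r` is negative, so the convention `s_{a,b} = 0` for `a < 0` never
intervenes. -/
theorem syndromeTrace_natCast (e : Point q F → F) (r : ℕ) (u : CoordRing q F) :
    syndromeTrace e r u = errorSum e (x q F ^ r * u) := by
  conv_rhs => rw [eq_sum_coeff u, Finset.mul_sum, map_sum]
  refine Finset.sum_congr rfl fun c _ => ?_
  rw [syndromeFunctional_natCast, mul_smul, x_pow_mul_eq_smul]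

theorem errorSum_smul_mul (e : Point q F → F) (p : F[X]) (u : CoordRing q F) :
    errorSum e (p • u) = p.sum fun a t => t * syndromeTrace e a u := by
  induction p using Polynomial.induction_on' with
  | add p p' hp hp' =>
    rw [add_smul, map_add, hp, hp', sum_add_index] <;> simp [add_mul]
  | monomial a t =>
    rw [sum_monomial_index _ _ (by simp), ← syndromeTrace_algebraMap_mul, syndromeTrace_natCast,
      algebraMap_mul_eq_smul, x_pow_mul_eq_smul, smul_smul, mul_comm, C_mul_X_pow_eq_monomial]

theorem errorSum_mul (e : Point q F → F) (h g : CoordRing q F) :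
    errorSum e (h * g) = ∑ c ∈ Finset.range q, ((stdRepr h).coeff c).sum fun a t =>
      t * syndromeTrace e a (y q F ^ c * g) := by
  conv_lhs => rw [eq_sum_coeff h, Finset.sum_mul, map_sum]
  refine Finset.sum_congr rfl fun c _ => ?_
  rw [smul_mul_assoc, errorSum_smul_mul]

theorem errorSum_mul_eq_zero {e : Point q F → F} {h g : CoordRing q F}
    (H : ∀ a b, stdCoeff h a b ≠ 0 → syndromeTrace e a (y q F ^ b * g) = 0) :
    errorSum e (h * g) = 0 := by
  rw [errorSum_mul]
  refine Finset.sum_eq_zero fun c _ => Finset.sum_eq_zero fun a ha => ?_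
  exact mul_eq_zero_of_right _ (H a c (mem_support_iff.1 ha))

/-- Expanding `h` in monomials, every term below the leading one pairs to zero with `g`, and
distinct monomials have distinct orders. -/
theorem errorSum_mul_eq_of_lead {e : Point q F → F} {h g : CoordRing q F} {a b : ℕ} (hb : b < q)
    (hle : ∀ a' b', stdCoeff h a' b' ≠ 0 → order q a' b' ≤ order q a b)
    (H : ∀ (a' b' : ℕ), b' < q → order q a' b' < order q a b →
      syndromeTrace e a' (y q F ^ b' * g) = 0) :
    errorSum e (h * g) = stdCoeff h a b * syndromeTrace e a (y q F ^ b * g) := by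
  have key : ∀ a' b', (a', b') ≠ (a, b) → stdCoeff h a' b' ≠ 0 →
      syndromeTrace e a' (y q F ^ b' * g) = 0 := by
    intro a' b' hne h'
    have hb' := lt_of_stdCoeff_ne_zero h'
    refine H a' b' hb' (lt_of_le_of_ne (hle a' b' h') fun heq => hne ?_)
    obtain ⟨h1, h2⟩ := order_injective hb' hb heq
    rw [h2]
    exact congrArg (·, b) (by exact_mod_cast h1)
  rw [errorSum_mul, Finset.sum_eq_single_of_mem b (Finset.mem_range.2 hb)]
  · rw [sum_def, Finset.sum_eq_single a]
    · rfl
    · intro a' ha' hne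
      exact mul_eq_zero_of_right _ (key a' b (by simpa using hne) (mem_support_iff.1 ha'))
    · intro ha
      rw [notMem_support_iff.1 ha, zero_mul]
  · intro c _ hc
    refine Finset.sum_eq_zero fun a' ha' => ?_
    exact mul_eq_zero_of_right _ (key a' c (by simp [hc]) (mem_support_iff.1 ha'))

end Trace

end

/-! ### Expansions in the `z*_j`, and the invariants of the algorithm. -/

section

variable {q : ℕ} {F : Type*} [Field F]

/-- The element `∑ c_j z*_j`. -/
def starSum (c : Fin q → F[X]) : CoordRing q F := ∑ j, c j • starBasis q F j

theorem starSum_smul (p : F[X]) (c : Fin q → F[X]) : starSum (p • c) = p • starSum c := by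
  simp [starSum, Finset.smul_sum, mul_smul]

theorem starSum_sub (c c' : Fin q → F[X]) : starSum (c - c') = starSum c - starSum c' := by
  simp [starSum, sub_smul]

theorem starSum_neg_single (j : Fin q) :
    starSum (-Pi.single j (1 : F[X])) = -starBasis q F j := by
  simp [starSum, Pi.single_apply]

/-- The coefficient of `X ^ k` in `p`, which is zero for `k < 0`. -/
def intCoeff (p : F[X]) (k : ℤ) : F := if 0 ≤ k then p.coeff k.toNat else 0

theorem intCoeff_of_neg (p : F[X]) {k : ℤ} (hk : k < 0) : intCoeff p k = 0 := if_neg (by omega)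

theorem intCoeff_natCast (p : F[X]) (k : ℕ) : intCoeff p k = p.coeff k := by
  simp [intCoeff]

theorem intCoeff_sub (p p' : F[X]) (k : ℤ) : intCoeff (p - p') k = intCoeff p k - intCoeff p' k := by
  unfold intCoeff; split_ifs <;> simp

theorem intCoeff_C_mul (t : F) (p : F[X]) (k : ℤ) : intCoeff (C t * p) k = t * intCoeff p k := by
  unfold intCoeff; split_ifs <;> simp

theorem intCoeff_X_pow_mul (n : ℕ) (p : F[X]) (k : ℤ) :
    intCoeff (X ^ n * p) k = intCoeff p (k - n) := by
  unfold intCoeff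
  rw [coeff_X_pow_mul']
  split_ifs with h1 h2 h3 h3
  · congr 1; omega
  · omega
  · omega
  · rfl
  · omega
  · rfl

theorem y_pow_card : y q F ^ q = x q F ^ (q + 1) - y q F := by
  have h : AdjoinRoot.mk (curvePoly q F) (curvePoly q F) = 0 := AdjoinRoot.mk_self
  conv_lhs at h => arg 2; unfold curvePoly
  rw [map_sub, map_add, map_pow, AdjoinRoot.mk_X, AdjoinRoot.mk_C, map_pow] at h
  exact eq_sub_of_add_eq (sub_eq_zero.1 h)

section Residual

variable [Fact (IsPrimePow q)]

/-- For these exponents a single substitution `y ^ q = x ^ (q+1) - y` reaches standard form, and `x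
^ (q+1)` has the order `q (q+1)` expected of `y ^ q`. The range covers all products `y ^ j y ^ i`
with `i, j < q`. -/
theorem order_le_of_stdCoeff_y_pow {n : ℕ} (hn : n < 2 * q - 1) (a b : ℕ)
    (h : stdCoeff (y q F ^ n) a b ≠ 0) : order q a b ≤ n * (q + 1) := by
  have hq := one_lt_of_primePow q
  have small : ∀ k < q, ∀ a b, stdCoeff (y q F ^ k) a b ≠ 0 → order q a b = k * (q + 1) := by
    intro k hk a b h
    rw [stdCoeff_y_pow hk] at h
    obtain ⟨rfl, rfl⟩ : b = k ∧ a = 0 := by by_contra hc; simp [hc] at h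
    simp [order]
  by_cases hnq : n < q
  · exact (small n hnq a b h).le
  · obtain ⟨k, rfl⟩ : ∃ k, n = q + k := ⟨n - q, by omega⟩
    rw [pow_add, y_pow_card, sub_mul, ← pow_succ', stdCoeff_sub] at h
    rcases ne_or_eq (stdCoeff (y q F ^ (k + 1)) a b) 0 with h1 | h1
    · rw [small _ (by omega) a b h1]
      exact mul_le_mul_of_nonneg_right (by push_cast; omega) (by positivity)
    · rw [h1, sub_zero] at h
      have := order_le_of_x_pow_mul (fun a b h => (small k (by omega) a b h).le) a b h
      refine this.trans (le_of_eq ?_)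
      push_cast
      ring

variable [Fintype F]

/-- The coefficient of `x ^ (-r-1) z*_j` in `f S - φ`, for `φ = ∑ c_j z*_j`. -/
def residual (e : Point q F → F) (f : CoordRing q F) (c : Fin q → F[X]) (r : ℤ) (j : Fin q) : F :=
  syndromeTrace e r (y q F ^ (j : ℕ) * f) - intCoeff (c j) (-r - 1)

theorem residual_sub (e : Point q F → F) (f g : CoordRing q F) (c c' : Fin q → F[X]) (r : ℤ)
    (j : Fin q) : residual e (f - g) (c - c') r j = residual e f c r j - residual e g c' r j := by
  unfold residual
  rw [mul_sub, syndromeTrace_sub, Pi.sub_apply, intCoeff_sub]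
  ring

theorem residual_C_mul (e : Point q F → F) (t : F) (f : CoordRing q F) (c : Fin q → F[X]) (r : ℤ)
    (j : Fin q) :
    residual e (algebraMap F (CoordRing q F) t * f) ((C t : F[X]) • c) r j =
      t * residual e f c r j := by
  unfold residual
  rw [mul_left_comm, syndromeTrace_algebraMap_mul, Pi.smul_apply, smul_eq_mul, intCoeff_C_mul]
  ring

theorem residual_x_pow_mul (e : Point q F → F) (n : ℕ) (f : CoordRing q F) (c : Fin q → F[X])
    (r : ℤ) (j : Fin q) :
    residual e (x q F ^ n * f) ((X ^ n : F[X]) • c) r j = residual e f c (r + n) j := by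
  unfold residual
  rw [mul_left_comm, syndromeTrace_x_pow_mul, Pi.smul_apply, smul_eq_mul, intCoeff_X_pow_mul]
  congr 2
  ring

theorem residual_natCast (e : Point q F → F) (f : CoordRing q F) (c : Fin q → F[X])
    (r : ℕ) (j : Fin q) : residual e f c r j = syndromeTrace e r (y q F ^ (j : ℕ) * f) := by
  unfold residual
  rw [intCoeff_of_neg _ (by omega), sub_zero]

/-- The state of `f = f_i`, `φ = φ_i` before iteration `m`: the leading monomial of `f` is
`x ^ a y ^ i`, and the coefficients of `f S - φ` of index below `m - ρ(f)` vanish. -/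
structure LocatorInvariant (e : Point q F → F) (m : ℤ) (a : ℕ) (i : Fin q)
    (f φ : CoordRing q F) : Prop where
  lead : stdCoeff f a i = 1
  le : ∀ a' b', stdCoeff f a' b' ≠ 0 → order q a' b' ≤ order q a i
  exists_star : ∃ c : Fin q → F[X], φ = starSum c ∧ ∀ (r : ℤ) (k : Fin q),
    (order q r k < m - order q a i → residual e f c r k = 0) ∧
    (m - order q a i ≤ order q r k → intCoeff (c k) (-r - 1) = 0)

/-- The state of `g = g_j`, `ψ = ψ_j` before iteration `m`, when the leading monomial of `f_j` is
`x ^ a y ^ j`: the leading monomial of `g S - ψ` is `x ^ (-a) z*_j`. -/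
structure AuxiliaryInvariant (e : Point q F → F) (m : ℤ) (a : ℕ) (j : Fin q)
    (g ψ : CoordRing q F) : Prop where
  lt : ∀ a' b', stdCoeff g a' b' ≠ 0 → order q a' b' + order q ((a : ℤ) - 1) j < m
  exists_star : ∃ c : Fin q → F[X], ψ = starSum c ∧ residual e g c ((a : ℤ) - 1) j = 1 ∧
    ∀ (r : ℤ) (k : Fin q),
    (order q r k < order q ((a : ℤ) - 1) j → residual e g c r k = 0) ∧
    (order q ((a : ℤ) - 1) j < order q r k → intCoeff (c k) (-r - 1) = 0)

theorem syndromeTrace_eq_zero {e : Point q F → F} {r : ℤ} {u : CoordRing q F}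
    (h : ∀ a b, stdCoeff u a b ≠ 0 → (a : ℤ) + r < 0) : syndromeTrace e r u = 0 := by
  unfold syndromeTrace syndromeFunctional
  refine Finset.sum_eq_zero fun c _ => ?_
  rw [lsum_apply, sum_def]
  refine Finset.sum_eq_zero fun a ha => ?_
  rw [syndromeValue, if_neg (not_le.2 (h a c (mem_support_iff.1 ha)))]
  simp

/-- At an index of order below `-ρ(y ^ i)`, every monomial of `y ^ k y ^ i` has `x`-exponent less
than `-r`, so only syndrome values with negative index occur. -/
theorem locatorInvariant_init (e : Point q F → F) (i : Fin q) :
    LocatorInvariant e 0 0 i (y q F ^ (i : ℕ)) 0 where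
  lead := by simp [stdCoeff_y_pow i.isLt]
  le a b h := by
    rw [stdCoeff_y_pow i.isLt] at h
    obtain ⟨rfl, rfl⟩ : b = i ∧ a = 0 := by by_contra hc; simp [hc] at h
    simp
  exists_star := by
    refine ⟨0, by simp [starSum], fun r k => ⟨fun h => ?_, fun _ => by simp [intCoeff]⟩⟩
    unfold residual
    rw [Pi.zero_apply, show intCoeff (0 : F[X]) (-r - 1) = 0 by simp [intCoeff], sub_zero]
    rw [← pow_add]
    refine syndromeTrace_eq_zero fun a b hab => ?_
    have h1 := order_le_of_stdCoeff_y_pow (by omega) a b hab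
    unfold order at h1 h
    push_cast at h1 h
    by_contra! h2
    have h3 : 0 ≤ ((a : ℤ) + r) * q := by positivity
    have h4 : (0 : ℤ) ≤ (b : ℤ) * (q + 1) := by positivity
    linarith

/-- Here `g S - ψ` is just `z*_j`, whose only coefficient sits at `r = -1`, that is, at `a = 0`. -/
theorem auxiliaryInvariant_init (e : Point q F → F) (j : Fin q) :
    AuxiliaryInvariant e 0 0 j 0 (-starBasis q F j) where
  lt a b h := absurd (stdCoeff_zero a b) h
  exists_star := by
    have hres : ∀ r k, residual e 0 (-Pi.single j (1 : F[X])) r k =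
        intCoeff ((Pi.single j (1 : F[X]) : Fin q → F[X]) k) (-r - 1) := by
      intro r k
      unfold residual
      have := intCoeff_C_mul (-1 : F) ((Pi.single j (1 : F[X]) : Fin q → F[X]) k) (-r - 1)
      simp only [map_neg, map_one, neg_mul, one_mul] at this
      rw [mul_zero, syndromeTrace_zero, Pi.neg_apply, this]
      ring
    have hne : ∀ (r : ℤ) (k : Fin q), order q r k ≠ order q (((0 : ℕ) : ℤ) - 1) j →
        intCoeff ((Pi.single j (1 : F[X]) : Fin q → F[X]) k) (-r - 1) = 0 := by
      intro r k h
      by_cases hk : k = j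
      · subst hk
        rw [Pi.single_eq_same]
        unfold intCoeff
        split_ifs with h0
        · rw [coeff_one, if_neg]
          intro h1
          apply h
          congr 1
          omega
        · rfl
      · rw [Pi.single_eq_of_ne hk]
        simp [intCoeff]
    refine ⟨-Pi.single j 1, (starSum_neg_single j).symm, ?_, fun r k => ⟨fun h => ?_, fun h => ?_⟩⟩
    · rw [hres, Pi.single_eq_same]
      simp [intCoeff]
    · rw [hres, hne _ _ h.ne]
    · have := hres r k
      rw [hne _ _ h.ne', residual, mul_zero, syndromeTrace_zero, zero_sub, neg_eq_zero] at this
      exact this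

theorem AuxiliaryInvariant.succ {e : Point q F → F} {m : ℤ} {a : ℕ} {j : Fin q}
    {g ψ : CoordRing q F} (h : AuxiliaryInvariant e m a j g ψ) :
    AuxiliaryInvariant e (m + 1) a j g ψ :=
  ⟨fun a' b' h' => (h.lt a' b' h').trans (lt_add_one m), h.exists_star⟩

end Residual

end

/-! ### One iteration preserves the invariants. -/

section

variable {q : ℕ} {F : Type*} [Field F]

theorem order_add (r s : ℤ) (j : ℕ) : order q (r + s) j = order q r j + s * q := by
  unfold order; ring

theorem partner_partner (m : ℕ) (i : Fin q) : partner m (partner m i) = i :=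
  (eq_partner (by rw [add_comm]; exact add_partner_modEq m i)).symm

theorem exists_partner_eq (m : ℕ) (i : Fin q) :
    ∃ t : ℤ, (m : ℤ) = t * q + ((i : ℕ) + (partner m i : ℕ)) * (q + 1) := by
  have h := (Nat.modEq_iff_dvd.1 (add_partner_modEq m i))
  obtain ⟨k, hk⟩ := h
  push_cast at hk
  exact ⟨k - (i + (partner m i : ℕ)), by linear_combination hk⟩

theorem starSum_C_smul (μ : F) (c : Fin q → F[X]) :
    starSum ((C μ : F[X]) • c) = algebraMap F (CoordRing q F) μ * starSum c := by
  rw [starSum_smul, algebraMap_mul_eq_smul]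

theorem starSum_X_pow_smul (n : ℕ) (c : Fin q → F[X]) :
    starSum ((X ^ n : F[X]) • c) = x q F ^ n * starSum c := by
  rw [starSum_smul, x_pow_mul_eq_smul]

variable [Fintype F] [Fact (IsPrimePow q)]

section Step

variable {e : Point q F → F} {m : ℤ} {a a' : ℕ} {i j : Fin q} {f φ g ψ : CoordRing q F}

/-- Only the index `(r, j)` has order exactly `m - ρ(f)`. There `φ` has no coefficient, so the
residual is the discrepancy itself. -/
theorem LocatorInvariant.succ_of_eq_zero (h : LocatorInvariant e m a i f φ) {r : ℤ}
    (hr : order q r j = m - order q a i) (hμ : syndromeTrace e r (y q F ^ (j : ℕ) * f) = 0) :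
    LocatorInvariant e (m + 1) a i f φ := by
  refine ⟨h.lead, h.le, ?_⟩
  obtain ⟨c, hc, H⟩ := h.exists_star
  refine ⟨c, hc, fun s k => ⟨fun hs => ?_, fun hs => (H s k).2 (by linarith)⟩⟩
  rcases lt_or_eq_of_le (show order q s k ≤ m - order q a i by linarith) with h1 | h1
  · exact (H s k).1 h1
  · obtain ⟨rfl, hk⟩ := order_injective k.isLt j.isLt (h1.trans hr.symm)
    obtain rfl := Fin.ext hk
    rw [residual, hμ, (H s k).2 h1.ge, sub_zero]

/-- Multiplication by `x ^ p` moves the leading coefficient `1` of `g S - ψ` to the index `(r, j)`,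
where it cancels `μ`. The order bound on `g` keeps `x ^ p g` strictly below the leading term of `f`.
-/
theorem LocatorInvariant.succ_of_gap_nonneg (h : LocatorInvariant e m a i f φ)
    (h' : AuxiliaryInvariant e m a' j g ψ) {r : ℤ} (hr : order q r j = m - order q a i)
    {p : ℕ} (hp : (p : ℤ) = a' - 1 - r) {μ : F}
    (hμ : syndromeTrace e r (y q F ^ (j : ℕ) * f) = μ) :
    LocatorInvariant e (m + 1) a i
      (f - algebraMap F (CoordRing q F) μ * (x q F ^ p * g))
      (φ - algebraMap F (CoordRing q F) μ * (x q F ^ p * ψ)) := by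
  have hr' : ((a' : ℤ) - 1) = r + p := by omega
  have hord : ∀ b c, stdCoeff (x q F ^ p * g) b c ≠ 0 → order q b c < order q a i := by
    intro b c hb
    have := order_le_of_x_pow_mul (d := m - order q ((a' : ℤ) - 1) j - 1)
      (fun b c hb => by have := h'.lt b c hb; omega) b c hb
    rw [hr', order_add, hr] at this
    linarith
  refine ⟨?_, fun b c hb => ?_, ?_⟩
  · rw [stdCoeff_sub, stdCoeff_algebraMap_mul, h.lead]
    by_cases h0 : stdCoeff (x q F ^ p * g) a i = 0
    · rw [h0, mul_zero, sub_zero]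
    · exact absurd (hord _ _ h0) (lt_irrefl _)
  · rw [stdCoeff_sub, stdCoeff_algebraMap_mul] at hb
    by_cases h0 : stdCoeff (x q F ^ p * g) b c = 0
    · rw [h0, mul_zero, sub_zero] at hb
      exact h.le b c hb
    · exact (hord _ _ h0).le
  · obtain ⟨c, hc, H⟩ := h.exists_star
    obtain ⟨c', hc', H1, H'⟩ := h'.exists_star
    refine ⟨c - (C μ : F[X]) • ((X ^ p : F[X]) • c'), ?_, fun s k => ?_⟩
    · rw [starSum_sub, starSum_C_smul, starSum_X_pow_smul, hc, hc']
    rw [residual_sub, residual_C_mul, residual_x_pow_mul, Pi.sub_apply, Pi.smul_apply,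
      Pi.smul_apply, smul_eq_mul, smul_eq_mul, intCoeff_sub, intCoeff_C_mul, intCoeff_X_pow_mul]
    have hs' : order q (s + p) k - order q ((a' : ℤ) - 1) j =
        order q s k - (m - order q a i) := by
      rw [hr', order_add, order_add, hr]; ring
    have hneg : -s - 1 - (p : ℤ) = -(s + p) - 1 := by ring
    rw [hneg]
    refine ⟨fun hs => ?_, fun hs => ?_⟩
    · rcases lt_or_eq_of_le (show order q s k ≤ m - order q a i by linarith) with h1 | h1
      · rw [(H s k).1 h1, (H' (s + p) k).1 (by linarith), mul_zero, sub_zero]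
      · obtain ⟨rfl, hk⟩ := order_injective k.isLt j.isLt (h1.trans hr.symm)
        obtain rfl := Fin.ext hk
        rw [residual, hμ, (H s k).2 h1.ge, ← hr', H1]
        ring
    · rw [(H s k).2 (by linarith), (H' (s + p) k).2 (by linarith), mul_zero, sub_zero]

/-- Now `g S - ψ` starts too early to be shifted up, so `f` is multiplied by `x ^ n` instead. This
moves its first nonzero residual to `(a' - 1, j)`, at the price of raising the exponent of `f` by
`n`. -/
theorem LocatorInvariant.succ_of_gap_neg (h : LocatorInvariant e m a i f φ)
    (h' : AuxiliaryInvariant e m a' j g ψ) {r : ℤ} (hr : order q r j = m - order q a i)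
    {n : ℕ} (hn : (n : ℤ) = r + 1 - a') {μ : F}
    (hμ : syndromeTrace e r (y q F ^ (j : ℕ) * f) = μ) :
    LocatorInvariant e (m + 1) (a + n) i
      (x q F ^ n * f - algebraMap F (CoordRing q F) μ * g)
      (x q F ^ n * φ - algebraMap F (CoordRing q F) μ * ψ) := by
  have hr' : r = ((a' : ℤ) - 1) + n := by omega
  have hdeg : order q ((a + n : ℕ) : ℤ) i = order q a i + n * q := by
    rw [Nat.cast_add, order_add]
  have hord : ∀ b c, stdCoeff g b c ≠ 0 → order q b c < order q ((a + n : ℕ) : ℤ) i := by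
    intro b c hb
    have := h'.lt b c hb
    rw [hr', order_add] at hr
    linarith
  refine ⟨?_, fun b c hb => ?_, ?_⟩
  · rw [stdCoeff_sub, stdCoeff_algebraMap_mul, stdCoeff_x_pow_mul_add, h.lead]
    by_cases h0 : stdCoeff g (a + n) i = 0
    · rw [h0, mul_zero, sub_zero]
    · exact absurd (hord _ _ h0) (lt_irrefl _)
  · rw [stdCoeff_sub, stdCoeff_algebraMap_mul] at hb
    by_cases h0 : stdCoeff g b c = 0
    · rw [h0, mul_zero, sub_zero] at hb
      rw [hdeg]
      exact order_le_of_x_pow_mul h.le b c hb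
    · exact (hord _ _ h0).le
  · obtain ⟨c, hc, H⟩ := h.exists_star
    obtain ⟨c', hc', H1, H'⟩ := h'.exists_star
    refine ⟨(X ^ n : F[X]) • c - (C μ : F[X]) • c', ?_, fun s k => ?_⟩
    · rw [starSum_sub, starSum_C_smul, starSum_X_pow_smul, hc, hc']
    rw [residual_sub, residual_C_mul, residual_x_pow_mul, Pi.sub_apply, Pi.smul_apply,
      Pi.smul_apply, smul_eq_mul, smul_eq_mul, intCoeff_sub, intCoeff_C_mul, intCoeff_X_pow_mul]
    have hneg : -s - 1 - (n : ℤ) = -(s + n) - 1 := by ring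
    rw [hneg, hdeg]
    have hs' : order q (s + n) k = order q s k + n * q := order_add _ _ _
    have hj : order q ((a' : ℤ) - 1) j = m - order q a i - n * q := by
      rw [hr', order_add] at hr; linarith
    refine ⟨fun hs => ?_, fun hs => ?_⟩
    · rcases lt_or_eq_of_le (show order q s k ≤ order q ((a' : ℤ) - 1) j by linarith) with h1 | h1
      · rw [(H (s + n) k).1 (by linarith), (H' s k).1 h1, mul_zero, sub_zero]
      · obtain ⟨rfl, hk⟩ := order_injective k.isLt j.isLt h1
        obtain rfl := Fin.ext hk
        rw [H1, ← hr', residual, hμ, (H r k).2 hr.ge]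
        ring
    · rw [(H (s + n) k).2 (by linarith), (H' s k).2 (by linarith), mul_zero, sub_zero]

/-- The first nonzero residual of the old `f` is `μ` at `(r, j)`; scaling by `μ⁻¹` makes it `1`. The
exponent `b = r + 1` is the one that `f_j` acquires in the same iteration. -/
theorem LocatorInvariant.auxiliaryInvariant (h : LocatorInvariant e m a i f φ) {r : ℤ}
    (hr : order q r j = m - order q a i) {b : ℕ} (hb : (b : ℤ) = r + 1) {μ : F}
    (hμ : syndromeTrace e r (y q F ^ (j : ℕ) * f) = μ) (h0 : μ ≠ 0) :
    AuxiliaryInvariant e (m + 1) b j (algebraMap F (CoordRing q F) μ⁻¹ * f)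
      (algebraMap F (CoordRing q F) μ⁻¹ * φ) := by
  have hb' : (b : ℤ) - 1 = r := by omega
  refine ⟨fun b' c' h' => ?_, ?_⟩
  · rw [stdCoeff_algebraMap_mul] at h'
    have := h.le b' c' (right_ne_zero_of_mul h')
    rw [hb', hr]
    linarith
  · obtain ⟨c, hc, H⟩ := h.exists_star
    refine ⟨(C μ⁻¹ : F[X]) • c, by rw [starSum_C_smul, hc], ?_,
      fun s k => ⟨fun hs => ?_, fun hs => ?_⟩⟩
    · rw [residual_C_mul, hb', residual, hμ, (H r j).2 hr.ge, sub_zero, inv_mul_cancel₀ h0]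
    · rw [hb', hr] at hs
      rw [residual_C_mul, (H s k).1 hs, mul_zero]
    · rw [hb', hr] at hs
      rw [Pi.smul_apply, smul_eq_mul, intCoeff_C_mul, (H s k).2 hs.le, mul_zero]

/-- Discrepancies as values of the error functional at a product. -/
theorem LocatorInvariant.syndromeTrace_eq (h : LocatorInvariant e m a i f φ)
    {f' φ' : CoordRing q F} {m' : ℤ} (h' : LocatorInvariant e m' a' j f' φ') {n : ℕ}
    (hr : order q ((a' + n : ℕ) : ℤ) j = m - order q a i) :
    syndromeTrace e ((a' + n : ℕ) : ℤ) (y q F ^ (j : ℕ) * f) =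
      errorSum e (x q F ^ n * f' * f) := by
  obtain ⟨c, hc, H⟩ := h.exists_star
  rw [errorSum_mul_eq_of_lead (a := a' + n) (b := j) j.isLt, stdCoeff_x_pow_mul_add, h'.lead,
    one_mul]
  · intro b c' hb
    rw [Nat.cast_add, order_add]
    exact order_le_of_x_pow_mul h'.le b c' hb
  · intro b c' hc' hlt
    rw [hr] at hlt
    have := (H b ⟨c', hc'⟩).1 hlt
    rwa [residual_natCast] at this

/-- If `n = t - a - a'` is nonnegative then the discrepancies of `f` and `f'` agree. -/
theorem LocatorInvariant.discrepancy_symm (h : LocatorInvariant e m a i f φ)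
    {f' φ' : CoordRing q F} (h' : LocatorInvariant e m a' j f' φ') {t : ℤ}
    (ht : m = t * q + (i + j) * (q + 1)) (hle : (a : ℤ) + a' ≤ t) :
    syndromeTrace e (t - a) (y q F ^ (j : ℕ) * f) =
      syndromeTrace e (t - a') (y q F ^ (i : ℕ) * f') := by
  obtain ⟨n, hn⟩ := Int.le.dest hle
  have h1 : t - a = ((a' + n : ℕ) : ℤ) := by push_cast; omega
  have h2 : t - a' = ((a + n : ℕ) : ℤ) := by push_cast; omega
  -- Both sides become the error functional at the same product `x ^ n * f * f'`.
  rw [h1, h2, h.syndromeTrace_eq h', h'.syndromeTrace_eq h]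
  · congr 1; ring
  · rw [← h2, ht]; unfold order; ring
  · rw [← h1, ht]; unfold order; ring

end Step

theorem LocatorInvariant.rhoInt_eq {e : Point q F → F} {m : ℤ} {a : ℕ} {i : Fin q}
    {f φ : CoordRing q F} (h : LocatorInvariant e m a i f φ) : rhoInt f = order q a i := by
  unfold rhoInt
  rw [rho_eq_of_lead (a := a) (b := i) (by rw [h.lead]; exact one_ne_zero) h.le]
  unfold order
  rw [show ((a * q + (i : ℕ) * (q + 1) : ℕ) : WithBot ℕ).unbotD 0 = a * q + (i : ℕ) * (q + 1)
    from rfl]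
  push_cast
  ring

theorem updateBlock_of_gap_nonneg {e : Point q F → F} {m : ℕ} {st : State q F} {i j : Fin q}
    (h : discrepancy e m st i j = 0 ∨ 0 ≤ gap m st i j) :
    updateBlock e m st i j =
      !![st.f i - algebraMap F (CoordRing q F) (discrepancy e m st i j) *
            (x q F ^ (gap m st i j).toNat * st.g j),
        st.φ i - algebraMap F (CoordRing q F) (discrepancy e m st i j) *
            (x q F ^ (gap m st i j).toNat * st.ψ j);
        st.g j, st.ψ j] := by
  rw [updateBlock, updateMatrix, if_pos h, Matrix.mul_fin_two]
  simp only [one_mul, zero_mul, zero_add, neg_mul, mul_assoc, sub_eq_add_neg]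

theorem updateBlock_of_gap_neg {e : Point q F → F} {m : ℕ} {st : State q F} {i j : Fin q}
    (h : ¬(discrepancy e m st i j = 0 ∨ 0 ≤ gap m st i j)) :
    updateBlock e m st i j =
      !![x q F ^ (-gap m st i j).toNat * st.f i -
          algebraMap F (CoordRing q F) (discrepancy e m st i j) * st.g j,
        x q F ^ (-gap m st i j).toNat * st.φ i -
          algebraMap F (CoordRing q F) (discrepancy e m st i j) * st.ψ j;
        algebraMap F (CoordRing q F) (discrepancy e m st i j)⁻¹ * st.f i,
        algebraMap F (CoordRing q F) (discrepancy e m st i j)⁻¹ * st.φ i] := by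
  rw [updateBlock, updateMatrix, if_neg h, Matrix.mul_fin_two]
  simp only [zero_mul, add_zero, neg_mul, sub_eq_add_neg]

/-- A pair `(i, j)` changes `f_i` together with `g_j`, and `f_j` together with `g_i`. The exponents
stay consistent because both changes fall under the same case of the update. -/
theorem invariants_run (e : Point q F → F) (m : ℕ) : ∃ a : Fin q → ℕ, ∀ i,
    LocatorInvariant e m (a i) i ((run e m).f i) ((run e m).φ i) ∧
    AuxiliaryInvariant e m (a i) i ((run e m).g i) ((run e m).ψ i) := by
  induction m with
  | zero =>
    exact ⟨fun _ => 0, fun i => ⟨locatorInvariant_init e i, auxiliaryInvariant_init e i⟩⟩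
  | succ m ih =>
    obtain ⟨a, ha⟩ := ih
    have hq0 : (q : ℤ) ≠ 0 := by have := one_lt_of_primePow q; omega
    -- With `m = t q + (i + j)(q + 1)` the integer divisions are exact: `r_i = t - a i` and `p = a i
    -- + a j - t - 1`.
    choose t ht using exists_partner_eq (q := q) m
    have htp : ∀ i, t (partner m i) = t i := by
      intro i
      have h1 := ht i
      have h2 := ht (partner m i)
      rw [partner_partner] at h2
      exact mul_right_cancel₀ hq0 (by linarith)
    have hshift : ∀ i, shift m (run e m) i (partner m i) = t i - a i := by
      intro i
      unfold shift
      rw [(ha i).1.rhoInt_eq]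
      apply Int.ediv_eq_of_eq_mul_right hq0
      rw [ht i]; unfold order; ring
    have hgap : ∀ i, gap m (run e m) i (partner m i) = a i + a (partner m i) - t i - 1 := by
      intro i
      unfold gap
      rw [(ha i).1.rhoInt_eq, (ha (partner m i)).1.rhoInt_eq]
      congr 1
      apply Int.ediv_eq_of_eq_mul_right hq0
      rw [ht i]; unfold order; ring
    have hord : ∀ i, order q (t i - a i) (partner m i) = m - order q (a i) i := by
      intro i
      rw [ht i]; unfold order; ring
    set μ : Fin q → F := fun i => discrepancy e m (run e m) i (partner m i) with hμdef
    have hμ : ∀ i, syndromeTrace e (t i - a i) (y q F ^ (partner m i : ℕ) * (run e m).f i) = μ i := by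
      intro i
      rw [hμdef]
      simp only
      rw [discrepancy_eq_syndromeTrace, hshift]
    have hsymm : ∀ i, (a i : ℤ) + a (partner m i) - t i - 1 < 0 → μ (partner m i) = μ i := by
      intro i hi
      have := (ha i).1.discrepancy_symm (ha (partner m i)).1 (ht i) (by omega)
      rw [hμ, ← htp i] at this
      have h2 := hμ (partner m i)
      rw [partner_partner] at h2
      rw [this, ← h2]
    classical
    -- In the swapping case both exponents grow by `-p`, giving `t + 1 - a j` for `f_i` and `t + 1 -
    -- a i` for `f_j`.
    refine ⟨fun i => if μ i = 0 ∨ 0 ≤ (a i : ℤ) + a (partner m i) - t i - 1 then a i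
      else a i + (-((a i : ℤ) + a (partner m i) - t i - 1)).toNat, fun i => ⟨?_, ?_⟩⟩
    · change LocatorInvariant e ((m + 1 : ℕ) : ℤ) _ i (updateBlock e m (run e m) i (partner m i) 0 0)
        (updateBlock e m (run e m) i (partner m i) 0 1)
      rw [Nat.cast_succ]
      beta_reduce
      split_ifs with hc
      · rw [updateBlock_of_gap_nonneg (by rw [hgap]; exact hc)]
        change LocatorInvariant _ _ _ _
          ((run e m).f i - algebraMap _ _ (μ i) * _) ((run e m).φ i - algebraMap _ _ (μ i) * _)
        by_cases h0 : μ i = 0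
        · rw [h0]
          simp only [map_zero, zero_mul, sub_zero]
          exact (ha i).1.succ_of_eq_zero (hord i) ((hμ i).trans h0)
        · exact (ha i).1.succ_of_gap_nonneg (ha (partner m i)).2 (hord i)
            (by rw [hgap, Int.toNat_of_nonneg (hc.resolve_left h0)]; ring) (hμ i)
      · rw [updateBlock_of_gap_neg (by rw [hgap]; exact hc), hgap]
        rw [not_or, not_le] at hc
        exact (ha i).1.succ_of_gap_neg (ha (partner m i)).2 (hord i)
            (by rw [Int.toNat_of_nonneg (by omega)]; ring) (hμ i)
    · change AuxiliaryInvariant e ((m + 1 : ℕ) : ℤ) _ i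
        (updateBlock e m (run e m) (partner m i) i 1 0)
        (updateBlock e m (run e m) (partner m i) i 1 1)
      rw [Nat.cast_succ]
      obtain ⟨k, rfl⟩ : ∃ k, i = partner m k := ⟨partner m i, (partner_partner m i).symm⟩
      simp only [partner_partner, htp]
      -- The gap is symmetric in the pair; the discrepancy matters only when the gap is negative,
      -- and then it is symmetric too.
      have hiff : (μ (partner m k) = 0 ∨ 0 ≤ (a (partner m k) : ℤ) + a k - t k - 1) ↔
          (μ k = 0 ∨ 0 ≤ (a k : ℤ) + a (partner m k) - t k - 1) := by
        rcases lt_or_ge ((a k : ℤ) + a (partner m k) - t k - 1) 0 with h | h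
        · rw [hsymm k h, add_comm (a k : ℤ)]
        · exact iff_of_true (Or.inr (by omega)) (Or.inr h)
      split_ifs with hc
      · rw [updateBlock_of_gap_nonneg (by rw [hgap]; exact hiff.1 hc)]
        exact (ha (partner m k)).2.succ
      · rw [updateBlock_of_gap_neg (by rw [hgap]; exact fun h => hc (hiff.2 h))]
        have hc' := mt hiff.2 hc
        rw [not_or, not_le] at hc'
        have hcast : ((a (partner m k) + (-((a (partner m k) : ℤ) + a k - t k - 1)).toNat : ℕ) : ℤ) =
            t k - a k + 1 := by
          rw [Nat.cast_add, Int.toNat_of_nonneg (by omega)]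
          ring
        exact (ha k).1.auxiliaryInvariant (hord k) hcast (hμ k) hc'.1

end

/-! ### Duality of `y ^ j` and `z*_j`, and the key equation for elements of `I^e`. -/

section

variable {q : ℕ} {F : Type*} [Field F]

theorem y_mul_starBasis_one (h : 1 < q) :
    y q F * starBasis q F ⟨1, h⟩ = starBasis q F ⟨0, by omega⟩ - 1 := by
  unfold starBasis
  rw [if_neg one_ne_zero, if_pos rfl, ← pow_succ', add_sub_cancel_right]
  congr 1
  simp only
  omega

theorem y_mul_starBasis_succ {b : ℕ} (hb : b ≠ 0) (h : b + 1 < q) :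
    y q F * starBasis q F ⟨b + 1, h⟩ = starBasis q F ⟨b, by omega⟩ := by
  unfold starBasis
  rw [if_neg (by simp), if_neg hb, ← pow_succ']
  congr 1
  simp only
  omega

theorem sum_mul_divByMonic {ι : Type*} (s : Finset ι) (a : F) (p : ι → F[X]) (t : ι → F) :
    (∑ i ∈ s, p i * C (t i)) /ₘ (X - C a) = ∑ i ∈ s, (p i /ₘ (X - C a)) * C (t i) := by
  have h : (X - C a : F[X]) ≠ 0 := X_sub_C_ne_zero a
  apply mul_left_cancel₀ h
  rw [X_sub_C_mul_divByMonic_eq_sub_modByMonic, modByMonic_X_sub_C_eq_C_eval, Finset.mul_sum,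
    eval_finsetSum, map_sum, ← Finset.sum_sub_distrib]
  refine Finset.sum_congr rfl fun i _ => ?_
  rw [← mul_assoc, X_sub_C_mul_divByMonic_eq_sub_modByMonic, modByMonic_X_sub_C_eq_C_eval, sub_mul,
    eval_mul, eval_C, C_mul]

open Classical in
-- Coefficient `k` of `p /ₘ (X - α)` is the sum of `p_a α ^ (a-k-1)` over `a > k`; discarding the
-- terms `a ≤ k` is exactly the convention for negative syndrome indices.
theorem syndromeFunctional_neg [Fintype F] (e : Point q F → F) (k c : ℕ) (p : F[X]) :
    syndromeFunctional e (-k - 1) c p =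
      ∑ P : Point q F, e P * ((p /ₘ (X - C P.1.1)).coeff k * P.1.2 ^ c) := by
  simp only [coeff_divByMonic_X_sub_C]
  rw [syndromeFunctional, lsum_apply, sum_over_range _ (by simp)]
  have hfil : Finset.Icc (k + 1) p.natDegree =
      (Finset.range (p.natDegree + 1)).filter (k + 1 ≤ ·) := by
    ext i; simp; omega
  simp only [hfil, Finset.sum_filter, Finset.sum_mul, Finset.mul_sum]
  rw [Finset.sum_comm]
  refine Finset.sum_congr rfl fun a _ => ?_
  rw [LinearMap.toSpanSingleton_apply, syndromeValue]
  by_cases h : k + 1 ≤ a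
  · rw [if_pos (by omega), smul_eq_mul, Finset.mul_sum]
    refine Finset.sum_congr rfl fun P _ => ?_
    rw [if_pos h, show ((a : ℤ) + (-k - 1)).toNat = a - (k + 1) by omega]
    ring
  · rw [if_neg (by omega)]
    simp [h]

variable [Fact (IsPrimePow q)]

section Casimir

theorem y_mul_starBasis_zero (h : 0 < q) :
    y q F * starBasis q F ⟨0, h⟩ = x q F ^ (q + 1) := by
  have hq := one_lt_of_primePow q
  unfold starBasis
  rw [if_pos rfl, mul_add, mul_one, ← pow_succ', Nat.sub_add_cancel h, y_pow_card, sub_add_cancel]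

theorem starBasis_last (h : q - 1 < q) : starBasis q F ⟨q - 1, h⟩ = 1 := by
  have hq := one_lt_of_primePow q
  unfold starBasis
  rw [if_neg (by simp only; omega)]
  simp

/-- Multiplication by `y` can be moved across `∑ z*_j ⊗ y ^ j`. -/
theorem starSum_y_mul (l : CoordRing q F →ₗ[F[X]] F[X]) (f : CoordRing q F) :
    starSum (fun j : Fin q => l (y q F ^ (j : ℕ) * (y q F * f))) =
      y q F * starSum (fun j : Fin q => l (y q F ^ (j : ℕ) * f)) := by
  have hq := one_lt_of_primePow q
  obtain ⟨n, rfl⟩ : ∃ n, q = n + 2 := ⟨q - 2, by omega⟩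
  unfold starSum
  simp only [← mul_assoc, ← pow_succ]
  -- Splitting off the last term on the left and the first two on the right aligns the sums. The
  -- `-y` in `y ^ q = x ^ (q+1) - y` then matches the `-1` in `y z*_1 = z*_0 - 1`.
  rw [Fin.sum_univ_castSucc, Fin.sum_univ_succ, Finset.mul_sum, Fin.sum_univ_succ,
    Fin.sum_univ_succ]
  have h0 : y (n + 2) F * starBasis (n + 2) F 0 = x (n + 2) F ^ (n + 2 + 1) :=
    y_mul_starBasis_zero (by omega)
  have h1 : y (n + 2) F * starBasis (n + 2) F (Fin.succ 0) = starBasis (n + 2) F 0 - 1 :=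
    y_mul_starBasis_one (by omega)
  have hl : starBasis (n + 2) F (Fin.last (n + 1)) = 1 := starBasis_last (by omega)
  have hs : ∀ i : Fin n, y (n + 2) F * starBasis (n + 2) F i.succ.succ =
      starBasis (n + 2) F (i.succ.castSucc) := fun i =>
    y_mul_starBasis_succ (b := i + 1) (by omega) (by omega)
  simp only [mul_smul_comm]
  rw [h0, h1, hl]
  have hy : y (n + 2) F ^ (n + 1 + 1) * f =
      (X ^ (n + 2 + 1) : F[X]) • f - y (n + 2) F * f := by
    rw [← x_pow_mul_eq_smul, ← sub_mul, ← y_pow_card]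
  simp only [Fin.val_last, Fin.val_castSucc, Fin.val_succ, hs, Fin.val_zero, Fin.castSucc_zero]
  rw [hy, map_sub, map_smul, sub_smul, smul_eq_mul, mul_smul, ← x_pow_mul_eq_smul]
  simp only [zero_add, pow_one, pow_zero, one_mul, smul_sub, mul_smul_comm]
  rw [mul_one]
  abel

end Casimir

/-- Evaluation of the standard representative at `y = β`. -/
def evalY (β : F) : CoordRing q F →ₗ[F[X]] F[X] :=
  (aeval (C β)).toLinearMap ∘ₗ AdjoinRoot.modByMonicHom (curvePoly_monic q F)

theorem evalY_eq_sum (β : F) (u : CoordRing q F) :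
    evalY β u = ∑ c ∈ Finset.range q, (stdRepr u).coeff c * C β ^ c := by
  change aeval (C β) (stdRepr u) = _
  rw [aeval_eq_sum_range' (natDegree_stdRepr_lt u)]
  simp

theorem evalY_y_pow (β : F) {c : ℕ} (hc : c < q) : evalY β (y q F ^ c) = C β ^ c := by
  have h := stdRepr_smul_y_pow (q := q) (1 : F[X]) hc
  rw [one_smul] at h
  change aeval (C β) (stdRepr (y q F ^ c)) = _
  rw [h]
  simp

theorem eval_evalY (P : Point q F) (u : CoordRing q F) :
    (evalY P.1.2 u).eval P.1.1 = evalAt P u := by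
  rw [evalY_eq_sum, evalAt_eq_sum, eval_finsetSum]
  simp

/-- The element `∑ β ^ j z*_j`, equal to `(y ^ q + y - β ^ q - β) / (y - β)`. -/
def pointNumerator (β : F) : CoordRing q F := starSum fun j : Fin q => C β ^ (j : ℕ)

/-- Moving powers of `y` across the sum reduces to `f = 1`, and `F[X]`-linearity does the rest. -/
theorem starSum_evalY (β : F) (f : CoordRing q F) :
    starSum (fun j : Fin q => evalY β (y q F ^ (j : ℕ) * f)) = f * pointNumerator β := by
  have hpow : ∀ c : ℕ, starSum (fun j : Fin q => evalY β (y q F ^ (j : ℕ) * y q F ^ c)) =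
      y q F ^ c * pointNumerator β := by
    intro c
    induction c with
    | zero =>
      rw [pow_zero, one_mul]
      unfold pointNumerator
      congr 1
      funext j
      rw [mul_one, evalY_y_pow _ j.isLt]
    | succ c ih => rw [pow_succ', starSum_y_mul, ih, mul_assoc]
  conv_rhs => rw [eq_sum_coeff f, Finset.sum_mul]
  simp only [smul_mul_assoc, ← hpow]
  conv_lhs => rw [eq_sum_coeff f]
  unfold starSum
  simp only [Finset.mul_sum, map_sum, mul_smul_comm, map_smul, Finset.sum_smul, Finset.smul_sum,
    smul_eq_mul, mul_smul]
  exact Finset.sum_comm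

/-- `evalY` evaluates after reduction, so it fails to be multiplicative only at `y ^ q`. In the
telescoping sum just the term `j = q - 1` survives: `x ^ (q+1) - β - β ^ q`, with `β ^ q + β = α ^
(q+1)` on the curve. -/
theorem sub_mul_pointNumerator (P : Point q F) :
    (y q F - algebraMap F (CoordRing q F) P.1.2) * pointNumerator P.1.2 =
      x q F ^ (q + 1) - algebraMap F (CoordRing q F) (P.1.1 ^ (q + 1)) := by
  have hq := one_lt_of_primePow q
  have h1 := starSum_evalY P.1.2 (y q F)
  rw [sub_mul, ← h1, algebraMap_mul_eq_smul, pointNumerator, ← starSum_smul, ← starSum_sub]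
  unfold starSum
  rw [Finset.sum_eq_single_of_mem ⟨q - 1, by omega⟩ (Finset.mem_univ _)]
  · rw [starBasis_last]
    simp only [Pi.sub_apply, Pi.smul_apply, smul_eq_mul]
    rw [← pow_succ, Nat.sub_add_cancel hq.le, y_pow_card, map_sub, ← mul_one (x q F ^ (q + 1)),
      x_pow_mul_eq_smul, map_smul, ← pow_zero (y q F), evalY_y_pow _ (by omega),
      ← pow_one (y q F), evalY_y_pow _ hq, ← pow_succ', Nat.sub_add_cancel hq.le, P.2]
    rw [← mul_one (algebraMap F _ _), algebraMap_mul_eq_smul]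
    simp [sub_smul, add_smul]
    ring
  · intro j _ hj
    have : (j : ℕ) + 1 < q := by
      have : (j : ℕ) ≠ q - 1 := fun h => hj (Fin.ext h)
      omega
    simp only [Pi.sub_apply, Pi.smul_apply, smul_eq_mul]
    rw [← pow_succ, evalY_y_pow _ this, pow_succ', sub_self, zero_smul]

/-- The polynomial part of `f (x^(q+1) - α^(q+1)) / ((x - α) (y - β))`. -/
def pointQuotient (P : Point q F) (f : CoordRing q F) (j : Fin q) : F[X] :=
  evalY P.1.2 (y q F ^ (j : ℕ) * f) /ₘ (X - C P.1.1)

/-- The remainder of `evalY β (y ^ j f)` modulo `X - α` is `β ^ j f(P)`, and these remainders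
assemble to `f(P)` times the point numerator. -/
theorem sub_mul_starSum_pointQuotient (P : Point q F) (f : CoordRing q F) :
    (x q F - algebraMap F (CoordRing q F) P.1.1) * starSum (pointQuotient P f) =
      (f - algebraMap F (CoordRing q F) (evalAt P f)) * pointNumerator P.1.2 := by
  have h1 : ∀ u : CoordRing q F, (x q F - algebraMap F (CoordRing q F) P.1.1) * u =
      (X - C P.1.1 : F[X]) • u := by
    intro u
    rw [sub_mul, sub_smul, algebraMap_mul_eq_smul]
    congr 1
    simpa using x_pow_mul_eq_smul 1 u
  rw [h1, ← starSum_smul, sub_mul, ← starSum_evalY, algebraMap_mul_eq_smul, pointNumerator,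
    ← starSum_smul, ← starSum_sub]
  congr 1
  funext j
  simp only [Pi.sub_apply, Pi.smul_apply, smul_eq_mul]
  rw [pointQuotient, X_sub_C_mul_divByMonic_eq_sub_modByMonic, modByMonic_X_sub_C_eq_C_eval,
    eval_evalY, map_mul (evalAt P), map_pow (evalAt P), evalAt_y, C_mul, C_pow, mul_comm (C P.1.2 ^ _)]

theorem x_sub_ne_zero (t : F) : x q F - algebraMap F (CoordRing q F) t ≠ 0 := by
  intro h
  have hq := one_lt_of_primePow q
  have h1 : stdCoeff (x q F - algebraMap F (CoordRing q F) t) 1 0 = 0 := by rw [h, stdCoeff_zero]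
  have h2 := stdCoeff_x_pow_mul 1 (y q F ^ 0) 1 0
  rw [← mul_one (algebraMap F _ t), stdCoeff_sub, stdCoeff_algebraMap_mul, ← pow_zero (y q F),
    stdCoeff_y_pow (by omega)] at h1
  rw [pow_one, stdCoeff_y_pow (by omega)] at h2
  rw [pow_zero, mul_one] at h2
  simp [h2] at h1

theorem y_sub_ne_zero (t : F) : y q F - algebraMap F (CoordRing q F) t ≠ 0 := by
  intro h
  have hq := one_lt_of_primePow q
  have h1 : stdCoeff (y q F - algebraMap F (CoordRing q F) t) 0 1 = 0 := by rw [h, stdCoeff_zero]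
  have h2 := stdCoeff_y_pow (F := F) hq 0 1
  rw [← mul_one (algebraMap F _ t), stdCoeff_sub, stdCoeff_algebraMap_mul, ← pow_zero (y q F),
    stdCoeff_y_pow (by omega)] at h1
  rw [pow_one] at h2
  simp [h2] at h1

section Finite

variable [Fintype F]

open Classical in
theorem syndromeTrace_neg (e : Point q F → F) (k : ℕ) (f : CoordRing q F) (j : Fin q) :
    syndromeTrace e (-k - 1) (y q F ^ (j : ℕ) * f) =
      ∑ P : Point q F, e P * (pointQuotient P f j).coeff k := by
  unfold syndromeTrace
  simp only [syndromeFunctional_neg]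
  rw [Finset.sum_comm]
  refine Finset.sum_congr rfl fun P _ => ?_
  rw [pointQuotient, evalY_eq_sum, ← Finset.mul_sum]
  simp only [← C_pow]
  rw [sum_mul_divByMonic, finsetSum_coeff]
  simp only [coeff_mul_C]

/-- Where `e_P ≠ 0` the remainder `f(P)` vanishes, so each summand of `f S` equals its polynomial
part. -/
theorem solvesKeyEquation_of_mem {e : Point q F → F} {f : CoordRing q F} (hf : f ∈ locatorIdeal e)
    {c : Fin q → F[X]} (hc : ∀ (k : ℕ) j, (c j).coeff k =
      syndromeTrace e (-k - 1) (y q F ^ (j : ℕ) * f)) :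
    SolvesKeyEquation e f (starSum c) := by
  classical
  have hc' : starSum c = ∑ P : Point q F,
      algebraMap F (CoordRing q F) (e P) * starSum (pointQuotient P f) := by
    have : c = fun j => ∑ P : Point q F, C (e P) * pointQuotient P f j := by
      funext j
      ext k
      rw [hc, syndromeTrace_neg, finsetSum_coeff]
      simp only [coeff_C_mul]
    rw [this]
    simp only [← starSum_C_smul]
    unfold starSum
    simp only [Finset.sum_smul]
    exact Finset.sum_comm
  unfold SolvesKeyEquation syndrome
  rw [hc', map_sum, Finset.mul_sum]
  refine Finset.sum_congr rfl fun P _ => ?_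
  rw [map_mul _ (algebraMap F _ _) (starSum _)]
  by_cases hP : e P = 0
  · simp [hP]
  rw [mul_left_comm]
  congr 1
  have h1 := sub_mul_starSum_pointQuotient P f
  rw [hf P hP, map_zero, sub_zero] at h1
  have hne : algebraMap (CoordRing q F) (FunField q F)
      ((x q F - algebraMap F (CoordRing q F) P.1.1) *
        (y q F - algebraMap F (CoordRing q F) P.1.2)) ≠ 0 := by
    rw [Ne, FaithfulSMul.algebraMap_eq_zero_iff]
    exact mul_ne_zero (x_sub_ne_zero _) (y_sub_ne_zero _)
  rw [mul_div_assoc', div_eq_iff hne, ← map_mul, ← map_mul, ← sub_mul_pointNumerator]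
  congr 1
  linear_combination -(y q F - algebraMap F (CoordRing q F) P.1.2) * h1

end Finite

end

/-! ### The footprint, the bound `ρ(f_i) ≤ σ_i`, and termination. -/

section

variable {q : ℕ} {F : Type*} [Field F]

theorem mem_locatorIdeal_of_errorSum [Fintype F] {e : Point q F → F} {f : CoordRing q F}
    (h : ∀ u, errorSum e (u * f) = 0) : f ∈ locatorIdeal e := by
  classical
  intro P hP
  -- A linear form vanishing at `Q` but not at `P`; the product over `Q ≠ P` isolates the term `e_P
  -- f(P)`.
  let sep : Point q F → CoordRing q F := fun Q =>
    if Q.1.1 = P.1.1 then y q F - algebraMap F (CoordRing q F) Q.1.2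
    else x q F - algebraMap F (CoordRing q F) Q.1.1
  have halg : ∀ (Q : Point q F) t, evalAt Q (algebraMap F (CoordRing q F) t) = t := by
    intro Q t
    rw [← mul_one (algebraMap F _ t), algebraMap_mul_eq_smul, evalAt_smul]
    simp
  have h1 : ∀ Q, evalAt Q (sep Q) = 0 := by
    intro Q
    simp only [sep]
    split_ifs
    · rw [map_sub, evalAt_y, halg, sub_self]
    · rw [map_sub, evalAt_x, halg, sub_self]
  have h2 : ∀ Q, Q ≠ P → evalAt P (sep Q) ≠ 0 := by
    intro Q hQ
    simp only [sep]
    split_ifs with hx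
    · rw [map_sub, evalAt_y, halg, sub_ne_zero]
      exact fun hy => hQ (Subtype.ext (Prod.ext hx hy.symm))
    · rw [map_sub, evalAt_x, halg, sub_ne_zero]
      exact fun h => hx h.symm
  have h3 := h (∏ Q ∈ Finset.univ.erase P, sep Q)
  rw [errorSum_apply, Finset.sum_eq_single_of_mem P (Finset.mem_univ P)] at h3
  · rw [map_mul, map_prod] at h3
    have h4 : ∏ Q ∈ Finset.univ.erase P, evalAt P (sep Q) ≠ 0 :=
      Finset.prod_ne_zero_iff.2 fun Q hQ => h2 Q (Finset.ne_of_mem_erase hQ)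
    exact ((mul_eq_zero.1 h3).resolve_left hP |> mul_eq_zero.1).resolve_left h4
  · intro Q _ hQ
    rw [map_mul, map_prod, Finset.prod_eq_zero (Finset.mem_erase.2 ⟨hQ, Finset.mem_univ Q⟩) (h1 Q),
      zero_mul, mul_zero]

variable [Fact (IsPrimePow q)]

/-- Elements of order `0` are nonzero constants, which vanish at no point. -/
theorem zero_mem_footprint {e : Point q F → F} (he : e ≠ 0) : 0 ∈ footprint e := by
  have hq := one_lt_of_primePow q
  refine ⟨⟨y q F ^ 0, ?_⟩, ?_⟩
  · have := rho_eq_of_lead (f := y q F ^ 0) (a := 0) (b := 0)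
      (by rw [stdCoeff_y_pow (by omega)]; simp)
      (fun a b h => by
        have := order_le_of_stdCoeff_y_pow (by omega) a b h
        simpa [order] using this)
    simpa using this
  · rintro ⟨f, hf, hrho⟩
    obtain ⟨⟨a, b, hab, h0⟩, hle⟩ := rho_eq_iff.1 hrho
    have hz : ∀ a b, stdCoeff f a b ≠ 0 → a = 0 ∧ b = 0 := by
      intro a b h
      have := Nat.le_zero.1 (hle a b h)
      rw [Nat.add_eq_zero_iff] at this
      constructor
      · exact (Nat.mul_eq_zero.1 this.1).resolve_right (by omega)
      · exact (Nat.mul_eq_zero.1 this.2).resolve_right (by omega)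
    obtain ⟨rfl, rfl⟩ := hz a b hab
    obtain ⟨P, hP⟩ := Function.ne_iff.1 he
    have hev := hf P hP
    rw [evalAt_eq_sum, Finset.sum_eq_single_of_mem 0 (Finset.mem_range.2 (by omega))] at hev
    · apply hab
      have : (stdRepr f).coeff 0 = C (stdCoeff f 0 0) := by
        ext a
        rw [coeff_C]
        split_ifs with ha
        · rw [ha]; rfl
        · by_contra hne
          exact ha (hz a 0 hne).1
      rw [this] at hev
      simpa using hev
    · intro c _ hc
      have : (stdRepr f).coeff c = 0 := by
        ext a
        by_contra hne
        exact hc (hz a c hne).2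
      rw [this]
      simp

theorem sigma_le_sigmaMax (e : Point q F → F) (i : Fin q) : sigma e i ≤ sigmaMax e :=
  Finset.le_sup (f := sigma e) (Finset.mem_univ i)

variable [Fintype F]

/-- The product of all `x - α_P` vanishes at every point; multiplying by `y ^ i` selects the residue
class. -/
theorem exists_mem_locatorIdeal_lead (e : Point q F → F) (i : Fin q) :
    ∃ n, n ∈ residueOrders e i := by
  classical
  let h : F[X] := ∏ P : Point q F, (X - C P.1.1)
  have hmon : h.Monic := monic_prod_of_monic _ _ fun P _ => monic_X_sub_C _
  refine ⟨h.natDegree * q + i * (q + 1), ⟨h • y q F ^ (i : ℕ), ?_, ?_⟩, ?_⟩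
  · intro P _
    rw [evalAt_smul, eval_prod, Finset.prod_eq_zero (Finset.mem_univ P), zero_mul]
    simp
  · apply rho_eq_of_lead
    · rw [stdCoeff_smul_y_pow _ i.isLt, if_pos rfl, coeff_natDegree, hmon.leadingCoeff]
      exact one_ne_zero
    · intro a b hab
      rw [stdCoeff_smul_y_pow _ i.isLt] at hab
      split_ifs at hab with hb
      · have := le_natDegree_of_ne_zero hab
        subst hb
        unfold order
        gcongr
      · exact absurd rfl hab
  · rw [Nat.modEq_iff_dvd]
    exact ⟨-(h.natDegree + i), by push_cast; ring⟩

theorem isLeast_sigma (e : Point q F → F) (i : Fin q) :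
    IsLeast (residueOrders e i) (sigma e i) :=
  ⟨Nat.sInf_mem (exists_mem_locatorIdeal_lead e i), fun _ hn => Nat.sInf_le hn⟩

/-- Elements of `I ^ e` of least order in their residue class. -/
theorem exists_lead_eq_sigma (e : Point q F → F) (i : Fin q) : ∃ f ∈ locatorIdeal e, ∃ s : ℕ,
    stdCoeff f s i ≠ 0 ∧ (∀ a b, stdCoeff f a b ≠ 0 → order q a b ≤ order q s i) ∧
    (sigma e i : ℤ) = order q s i := by
  obtain ⟨⟨f, hf, hrho⟩, hmod⟩ := (isLeast_sigma e i).1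
  obtain ⟨⟨s, b, hs, hsb⟩, hle⟩ := rho_eq_iff.1 hrho
  have hb := lt_of_stdCoeff_ne_zero hs
  have hbi : b = i := by
    refine Nat.ModEq.eq_of_lt_of_lt (Nat.ModEq.trans ?_ hmod) hb i.isLt
    rw [← hsb, Nat.modEq_iff_dvd]
    exact ⟨s + b, by push_cast; ring⟩
  subst hbi
  have hord : (sigma e i : ℤ) = order q s i := by rw [← hsb]; unfold order; push_cast; ring
  refine ⟨f, hf, s, hs, fun a b hab => ?_, hord⟩
  rw [← hord]
  have := hle a b hab
  unfold order
  exact_mod_cast this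

/-- Multiplying a minimal element by powers of `x` reaches every order in its class from `σ_b` on,
so such orders are not in the footprint. This bounds the footprint. -/
theorem lt_sigmaMax_of_mem_footprint {e : Point q F → F} {n : ℕ} (hn : n ∈ footprint e) :
    n < sigmaMax e := by
  obtain ⟨⟨u, hu⟩, hn⟩ := hn
  obtain ⟨⟨a, b, hab, rfl⟩, -⟩ := rho_eq_iff.1 hu
  have hb := lt_of_stdCoeff_ne_zero hab
  obtain ⟨f, hf, s, hs, hle, hσ⟩ := exists_lead_eq_sigma e ⟨b, hb⟩
  have hmax : sigma e ⟨b, hb⟩ ≤ sigmaMax e := Finset.le_sup (Finset.mem_univ _)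
  refine lt_of_lt_of_le ?_ hmax
  by_contra! hge
  apply hn
  have hsa : s ≤ a := by
    have hq : 0 < q := by omega
    have h1 : ((sigma e ⟨b, hb⟩ : ℕ) : ℤ) ≤ ((a * q + b * (q + 1) : ℕ) : ℤ) := by exact_mod_cast hge
    rw [hσ] at h1
    unfold order at h1
    push_cast at h1
    have h2 : (s : ℤ) * q ≤ a * q := by linarith
    exact_mod_cast le_of_mul_le_mul_right h2 (by exact_mod_cast hq)
  obtain ⟨p, rfl⟩ := Nat.exists_eq_add_of_le hsa
  refine ⟨x q F ^ p * f, Ideal.mul_mem_left _ _ hf, rho_eq_of_lead ?_ ?_⟩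
  · rwa [stdCoeff_x_pow_mul_add]
  · intro a' b' h'
    rw [Nat.cast_add, order_add]
    exact order_le_of_x_pow_mul hle a' b' h'

theorem bddAbove_footprint (e : Point q F → F) : BddAbove (footprint e) :=
  ⟨sigmaMax e, fun _ hn => (lt_sigmaMax_of_mem_footprint hn).le⟩

theorem isGreatest_deltaMax {e : Point q F → F} (he : e ≠ 0) :
    IsGreatest (footprint e) (deltaMax e) :=
  ⟨Nat.sSup_mem ⟨0, zero_mem_footprint he⟩ (bddAbove_footprint e),
    fun _ hn => le_csSup (bddAbove_footprint e) hn⟩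

/-- Modulo `I ^ e` every element is congruent to one of order at most `δ_max`. -/
theorem exists_sub_mem_locatorIdeal (e : Point q F → F) (u : CoordRing q F) :
    ∃ w, u - w ∈ locatorIdeal e ∧
      ∀ a b, stdCoeff w a b ≠ 0 → a * q + b * (q + 1) ≤ deltaMax e := by
  have key : ∀ (N : ℕ) (u : CoordRing q F),
      (∀ a b, stdCoeff u a b ≠ 0 → a * q + b * (q + 1) < N) → ∃ w, u - w ∈ locatorIdeal e ∧
        ∀ a b, stdCoeff w a b ≠ 0 → a * q + b * (q + 1) ≤ deltaMax e := by
    intro N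
    induction N with
    | zero => exact fun u hu => ⟨u, by simp, fun a b h => absurd (hu a b h) (Nat.not_lt_zero _)⟩
    | succ N ih =>
      intro u hu
      by_cases hN : N ≤ deltaMax e
      · exact ⟨u, by simp, fun a b h => (Nat.lt_succ_iff.1 (hu a b h)).trans hN⟩
      by_cases hlead : ∃ a b, stdCoeff u a b ≠ 0 ∧ a * q + b * (q + 1) = N
      · have hrho : rho u = (N : WithBot ℕ) :=
          rho_eq_iff.2 ⟨hlead, fun a b h => Nat.lt_succ_iff.1 (hu a b h)⟩
        -- An order above `δ_max` that occurs at all occurs in `I^e`, so the leading term of `u` can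
        -- be cancelled.
        obtain ⟨f, hf, hrf⟩ : N ∈ ordersOf (locatorIdeal e) := by
          by_contra hne
          exact hN (le_csSup (bddAbove_footprint e) ⟨⟨u, hrho⟩, hne⟩)
        obtain ⟨a, b, hab, habN⟩ := hlead
        obtain ⟨⟨a', b', hab', habN'⟩, hlef⟩ := rho_eq_iff.1 hrf
        have huniq : ∀ a₁ b₁, b₁ < q → a₁ * q + b₁ * (q + 1) = N → a₁ = a ∧ b₁ = b := by
          intro a₁ b₁ hb₁ h₁
          have := order_injective (q := q) (r := a₁) (r' := a) hb₁ (lt_of_stdCoeff_ne_zero hab)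
            (by unfold order; exact_mod_cast h₁.trans habN.symm)
          exact ⟨by exact_mod_cast this.1, this.2⟩
        obtain ⟨rfl, rfl⟩ := huniq a' b' (lt_of_stdCoeff_ne_zero hab') habN'
        set t := stdCoeff u a' b' / stdCoeff f a' b' with ht
        obtain ⟨w, hw, hwδ⟩ := ih (u - algebraMap F (CoordRing q F) t * f) (by
          intro a₁ b₁ h₁
          rw [stdCoeff_sub, stdCoeff_algebraMap_mul] at h₁
          have hle : a₁ * q + b₁ * (q + 1) ≤ N ∧ b₁ < q := by
            by_cases h0 : stdCoeff u a₁ b₁ = 0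
            · rw [h0, zero_sub, neg_ne_zero] at h₁
              have h2 := right_ne_zero_of_mul h₁
              exact ⟨hlef _ _ h2, lt_of_stdCoeff_ne_zero h2⟩
            · exact ⟨Nat.lt_succ_iff.1 (hu _ _ h0), lt_of_stdCoeff_ne_zero h0⟩
          refine lt_of_le_of_ne hle.1 fun heq => h₁ ?_
          obtain ⟨rfl, rfl⟩ := huniq a₁ b₁ hle.2 heq
          rw [ht, div_mul_cancel₀ _ hab', sub_self])
        refine ⟨w, ?_, hwδ⟩
        have := add_mem hw (Ideal.mul_mem_left _ (algebraMap F (CoordRing q F) t) hf)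
        convert this using 1
        ring
      · push Not at hlead
        exact ih u fun a b h => lt_of_le_of_ne (Nat.lt_succ_iff.1 (hu a b h)) (hlead a b h)
  refine key ((rho u).unbotD 0 + 1) u fun a b h => Nat.lt_succ_iff.2 ?_
  obtain ⟨n, hn⟩ := exists_rho_eq (f := u) (by rintro rfl; exact h (stdCoeff_zero a b))
  rw [hn]
  exact rho_le_iff.1 hn.le a b h

/-- Suppose `a > s`, the exponent of a minimal `f ∈ I^e`. Then `x ^ (a-1-s) f` leads at the index
where `g S - ψ` does, so `errorSum` of its product with `g` is the nonzero leading coefficient of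
`f`; yet the product lies in `I^e`. -/
theorem AuxiliaryInvariant.order_le_sigma {e : Point q F → F} {m : ℤ} {a : ℕ} {i : Fin q}
    {g ψ : CoordRing q F} (h : AuxiliaryInvariant e m a i g ψ) :
    order q a i ≤ sigma e i := by
  have hq := one_lt_of_primePow q
  obtain ⟨f, hf, s, hs, hle, hσ⟩ := exists_lead_eq_sigma e i
  rw [hσ]
  suffices a ≤ s by
    unfold order
    gcongr
  by_contra! hlt
  obtain ⟨p, rfl⟩ : ∃ p, a = s + p + 1 := ⟨a - s - 1, by omega⟩
  obtain ⟨c, -, h1, hc⟩ := h.exists_star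
  have hcast : (((s + p + 1 : ℕ) : ℤ) - 1) = ((s + p : ℕ) : ℤ) := by push_cast; ring
  rw [hcast] at h1 hc
  -- The index `a - 1 = s + p` is nonnegative, so `ψ` does not contribute.
  rw [residual_natCast] at h1
  have key := errorSum_mul_eq_of_lead (e := e) (h := x q F ^ p * f) (g := g) (a := s + p) i.isLt
    (fun a' b' h' => by
      rw [Nat.cast_add, order_add]
      exact order_le_of_x_pow_mul hle a' b' h')
    (fun a' b' hb' hlt => by
      have := (hc a' ⟨b', hb'⟩).1 hlt
      rwa [residual_natCast] at this)
  rw [h1, mul_one, stdCoeff_x_pow_mul_add, errorSum_eq_zero_of_mem] at key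
  · exact hs key.symm
  · exact Ideal.mul_mem_right _ _ (Ideal.mul_mem_left _ _ hf)

/-- Since `ρ(f_i) ≤ σ_max`, the vanishing range `m - ρ(f_i)` exceeds `δ_max`, and representatives of
order at most `δ_max` test membership in `I^e`. -/
theorem run_f_mem_locatorIdeal {e : Point q F → F} {m : ℕ} (hm : sigmaMax e + deltaMax e < m)
    (i : Fin q) : (run e m).f i ∈ locatorIdeal e := by
  obtain ⟨a, ha⟩ := invariants_run e m
  obtain ⟨hf, hg⟩ := ha i
  have hσ := hg.order_le_sigma
  have hσ' := sigma_le_sigmaMax e i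
  obtain ⟨c, -, H⟩ := hf.exists_star
  refine mem_locatorIdeal_of_errorSum fun u => ?_
  obtain ⟨w, hw, hwδ⟩ := exists_sub_mem_locatorIdeal e u
  rw [← sub_add_cancel u w, add_mul, map_add,
    errorSum_eq_zero_of_mem (Ideal.mul_mem_right _ _ hw), zero_add]
  refine errorSum_mul_eq_zero fun r b hrb => ?_
  have := (H r ⟨b, lt_of_stdCoeff_ne_zero hrb⟩).1 (by
    have h1 := hwδ r b hrb
    have h2 : order q r b = ((r * q + b * (q + 1) : ℕ) : ℤ) := by unfold order; push_cast; ring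
    simp only [h2]
    omega)
  rwa [residual_natCast] at this

theorem run_solvesKeyEquation (e : Point q F → F) (i : Fin q) :
    SolvesKeyEquation e ((run e (lastIteration e + 1)).f i)
      ((run e (lastIteration e + 1)).φ i) := by
  have hq := one_lt_of_primePow q
  have hmem : (run e (lastIteration e + 1)).f i ∈ locatorIdeal e :=
    run_f_mem_locatorIdeal (by unfold lastIteration; omega) i
  obtain ⟨a, ha⟩ := invariants_run e (lastIteration e + 1)
  obtain ⟨hf, hg⟩ := ha i
  have hσ := hg.order_le_sigma
  have hσ' := sigma_le_sigmaMax e i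
  obtain ⟨c, hc, H⟩ := hf.exists_star
  rw [hc]
  refine solvesKeyEquation_of_mem hmem fun k j => ?_
  have h1 := (H (-k - 1) j).1 (by
    have h2 : sigmaMax e + (q ^ 2 - q - 1) ≤ lastIteration e := by unfold lastIteration; omega
    have h3 : q + 1 ≤ q ^ 2 := by nlinarith
    have h4 : ((q ^ 2 - q - 1 : ℕ) : ℤ) = (q : ℤ) ^ 2 - q - 1 := by
      rw [Nat.sub_sub, Nat.cast_sub h3]; push_cast; ring
    -- The largest order of an index with `r < 0` is `-q + (q - 1)(q + 1)`, at `r = -1` and `j = q -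
    -- 1`.
    have h5 : order q (-k - 1) j ≤ (q : ℤ) ^ 2 - q - 1 := by
      unfold order
      have hj : ((j : ℕ) : ℤ) ≤ q - 1 := by have := j.isLt; omega
      have hk : (0 : ℤ) ≤ (k : ℤ) * q := by positivity
      nlinarith
    have h2' : (sigmaMax e : ℤ) + ((q ^ 2 - q - 1 : ℕ) : ℤ) ≤ lastIteration e := by
      exact_mod_cast h2
    have h6 : (sigma e i : ℤ) ≤ sigmaMax e := by exact_mod_cast hσ'
    rw [h4] at h2'
    push_cast
    linarith)
  unfold residual at h1
  rw [show -(-(k : ℤ) - 1) - 1 = k by ring, intCoeff_natCast, sub_eq_zero] at h1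
  exact h1.symm

end

end

end Hermitian

theorem mainTheorem7 {q : ℕ} [Fact (IsPrimePow q)] {F : Type*} [Field F] [Fintype F]
    (hF : Fintype.card F = q ^ 2) (e : Hermitian.Point q F → F) :
    (∀ i : Fin q, IsLeast (Hermitian.residueOrders e i) (Hermitian.sigma e i)) ∧
    (e ≠ 0 → IsGreatest (Hermitian.footprint e) (Hermitian.deltaMax e)) ∧
    (∀ m : ℕ, Hermitian.sigmaMax e + Hermitian.deltaMax e < m →
      ∀ i : Fin q, (Hermitian.run e m).f i ∈ Hermitian.locatorIdeal e) ∧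
    (∀ i : Fin q, Hermitian.SolvesKeyEquation e
      ((Hermitian.run e (Hermitian.lastIteration e + 1)).f i)
      ((Hermitian.run e (Hermitian.lastIteration e + 1)).φ i)) :=
  ⟨Hermitian.isLeast_sigma e, Hermitian.isGreatest_deltaMax,
    fun _ hm i => Hermitian.run_f_mem_locatorIdeal hm i, Hermitian.run_solvesKeyEquation e⟩
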